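/- **Theorem (Isometry Theorem for p.f.d. persistence modules).** Let $K$ be a field. A persistence module $M$ over $K$ is a functor from the poset $\mathbb{R}$ to $K$-vector spaces, with spaces $M_t$ and transition maps $\varphi_M(s,t):M_s\to M_t$ for $s\le t$; it is pointwise finite-dimensional (p.f.d.) if $\dim M_t<\infty$ for all $t$. For $\delta\in\mathbb{R}$, let $M(\delta)$ be the shifted module with $M(\delta)_t=M_{t+\delta}$ and $\varphi_{M(\delta)}(s,t)=\varphi_M(s+\delta,t+\delta)$, and for a morphism $f$ let $f(\delta)_t=f_{t+\delta}$. For $\delta\ge 0$, $M$ and $N$ are $\delta$-interleaved if there are morphisms $f:M\to N(\delta)$ and $g:N\to M(\delta)$ such that, for every $t$, $(g(\delta)\circ f)_t=\varphi_M(t,t+2\delta)$ and $(f(\delta)\circ g)_t=\varphi_N(t,t+2\delta)$. Put $d_I(M,N)=\inf\{\delta\in[0,\infty) : M,N \text{ are } \delta\text{-interleaved}\}\in[0,\infty]$. Decorated endpoints are the elements of $\mathbb{E}=(\mathbb{R}\times\{-,+\})\cup\{-\infty,\infty\}$; write $t^\pm=(t,\pm)$, order $\mathbb{R}\times\{-,+\}$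 lexicographically with $-<+$, with $-\infty$ the minimum and $\infty$ the maximum of $\mathbb{E}$, and set $s^\pm+t=(s+t)^\pm$, $\pm\infty+t=\pm\infty$, $e-t=e+(-t)$ for $e\in\mathbb{E}$, $s,t\in\mathbb{R}$. For $b<d$ in $\mathbb{E}$ let $\langle b,d\rangle=\{t\in\mathbb{R} : b\le t^-\text{ and }t^+\le d\}$; every nonempty interval of $\mathbb{R}$ is $\langle b,d\rangle$ for exactly one pair $b<d$. A barcode is a multiset of nonempty intervals of $\mathbb{R}$ with finite multiplicities, repeated intervals being regarded as distinct elements. The interval module $C(I)$ has $C(I)_t=K$ for $t\in I$ and $0$ otherwise, with transition map $\mathrm{id}_K$ if $s,t\in I$ and $0$ otherwise. A barcode $\mathcal{B}(M)$ is a barcode of $M$ if $M\cong\bigoplus_{I\in\mathcal{B}(M)}C(I)$. For $\delta\ge 0$, a $\delta$-matching between barcodes $\mathcal{C}$ and $\mathcal{D}$ is a bijection $\sigma$ from a subset of $\mathcal{C}$ onto a subset of $\mathcal{D}$ such that (i) every $\langle b,d\rangle\in\mathcal{C}$ with $b+2\delta<d$ is in the domain of $\sigma$; (ii) every $\langle b,d\rangle\in\mathcal{D}$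 with $b+2\delta<d$ is in the image of $\sigma$; (iii) if $\sigma\langle b,d\rangle=\langle b',d'\rangle$, then $\langle b,d\rangle\subseteq\langle b'-\delta,d'+\delta\rangle$ and $\langle b',d'\rangle\subseteq\langle b-\delta,d+\delta\rangle$. Put $d_B(\mathcal{C},\mathcal{D})=\inf\{\delta\in[0,\infty) : \text{there is a } \delta\text{-matching between } \mathcal{C} \text{ and } \mathcal{D}\}\in[0,\infty]$. Let $M$ and $N$ be p.f.d. persistence modules over $K$. Then each of $M$ and $N$ has exactly one barcode, denoted $\mathcal{B}(M)$ and $\mathcal{B}(N)$ respectively; for every $\delta\ge 0$, $M$ and $N$ are $\delta$-interleaved if and only if there is a $\delta$-matching between $\mathcal{B}(M)$ and $\mathcal{B}(N)$; and $$d_B(\mathcal{B}(M),\mathcal{B}(N))=d_I(M,N).$$ -/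

import Mathlib

open CategoryTheory
open scoped NNReal ENNReal DirectSum

namespace Persistence

universe u

/-! ### Decorated endpoints and intervals -/

/-- The decorated endpoints `ℝ × {-, +} ∪ {-∞, ∞}`, with the lexicographic order on `ℝ × {-, +}`
(`false` plays the role of `-` and `true` that of `+`, so that `- < +`), `-∞` as minimum and
`∞` as maximum. -/
abbrev Endpoint : Type := WithBot (WithTop (ℝ ×ₗ Bool))

/-- The decorated endpoint `t⁻`. -/
def Endpoint.minus (t : ℝ) : Endpoint := ((toLex (t, false) : ℝ ×ₗ Bool) : WithTop (ℝ ×ₗ Bool))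

/-- The decorated endpoint `t⁺`. -/
def Endpoint.plus (t : ℝ) : Endpoint := ((toLex (t, true) : ℝ ×ₗ Bool) : WithTop (ℝ ×ₗ Bool))

/-- Translation of decorated endpoints: `s^± + t = (s + t)^±` and `±∞ + t = ±∞`. -/
def Endpoint.shift (e : Endpoint) (t : ℝ) : Endpoint :=
  WithBot.map (WithTop.map fun p : ℝ ×ₗ Bool => toLex ((ofLex p).1 + t, (ofLex p).2)) e

/-- The set of reals `⟨b, d⟩` between two decorated endpoints: `t` belongs to it if and only if
`b ≤ t⁻` and `t⁺ ≤ d`. For instance `⟨s⁻, t⁻⟩ = [s, t)` and `⟨s⁺, t⁺⟩ = (s, t]`. -/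
def span (b d : Endpoint) : Set ℝ := {t | b ≤ Endpoint.minus t ∧ Endpoint.plus t ≤ d}

theorem Endpoint.coe_le_coe_iff (s t : ℝ) (i j : Bool) :
    (((toLex (s, i) : ℝ ×ₗ Bool) : WithTop (ℝ ×ₗ Bool)) : Endpoint) ≤
      ((toLex (t, j) : ℝ ×ₗ Bool) : WithTop (ℝ ×ₗ Bool)) ↔ s < t ∨ s = t ∧ i ≤ j := by
  rw [WithBot.coe_le_coe, WithTop.coe_le_coe, Prod.Lex.toLex_le_toLex]

theorem Endpoint.minus_le_minus_iff (s t : ℝ) :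
    Endpoint.minus s ≤ Endpoint.minus t ↔ s ≤ t := by
  refine (Endpoint.coe_le_coe_iff s t _ _).trans ?_
  simp [le_iff_lt_or_eq (a := s)]

theorem Endpoint.plus_le_plus_iff (s t : ℝ) :
    Endpoint.plus s ≤ Endpoint.plus t ↔ s ≤ t := by
  refine (Endpoint.coe_le_coe_iff s t _ _).trans ?_
  simp [le_iff_lt_or_eq (a := s)]

theorem Endpoint.minus_le_plus_iff (s t : ℝ) :
    Endpoint.minus s ≤ Endpoint.plus t ↔ s ≤ t := by
  refine (Endpoint.coe_le_coe_iff s t _ _).trans ?_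
  simp [le_iff_lt_or_eq (a := s)]

theorem Endpoint.plus_le_minus_iff (s t : ℝ) :
    Endpoint.plus s ≤ Endpoint.minus t ↔ s < t := by
  refine (Endpoint.coe_le_coe_iff s t _ _).trans ?_
  simp

theorem Endpoint.minus_lt_plus (t : ℝ) : Endpoint.minus t < Endpoint.plus t := by
  rw [← not_le, Endpoint.plus_le_minus_iff]
  exact lt_irrefl t

theorem Endpoint.eq_cases (e : Endpoint) :
    e = ⊥ ∨ (∃ t, e = Endpoint.minus t) ∨ (∃ t, e = Endpoint.plus t) ∨ e = ⊤ := by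
  induction e using WithBot.recBotCoe with
  | bot => exact Or.inl rfl
  | coe e =>
    induction e using WithTop.recTopCoe with
    | top => exact Or.inr (Or.inr (Or.inr rfl))
    | coe p =>
      obtain ⟨⟨t, i⟩, rfl⟩ := toLex.surjective p
      cases i
      · exact Or.inr (Or.inl ⟨t, rfl⟩)
      · exact Or.inr (Or.inr (Or.inl ⟨t, rfl⟩))

theorem span_nonempty {b d : Endpoint} (h : b < d) : (span b d).Nonempty := by
  rcases b.eq_cases with rfl | ⟨s, rfl⟩ | ⟨s, rfl⟩ | rfl
  · rcases d.eq_cases with rfl | ⟨t, rfl⟩ | ⟨t, rfl⟩ | rfl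
    · exact absurd h (lt_irrefl _)
    · exact ⟨t - 1, bot_le, (Endpoint.plus_le_minus_iff _ _).2 (by linarith)⟩
    · exact ⟨t, bot_le, le_rfl⟩
    · exact ⟨0, bot_le, le_top⟩
  · refine ⟨s, le_rfl, ?_⟩
    rcases d.eq_cases with rfl | ⟨t, rfl⟩ | ⟨t, rfl⟩ | rfl
    · exact absurd h not_lt_bot
    · rw [← not_le, Endpoint.minus_le_minus_iff, not_le] at h
      rwa [Endpoint.plus_le_minus_iff]
    · rw [Endpoint.plus_le_plus_iff]
      exact (Endpoint.minus_le_plus_iff s t).1 h.le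
    · exact le_top
  · rcases d.eq_cases with rfl | ⟨t, rfl⟩ | ⟨t, rfl⟩ | rfl
    · exact absurd h not_lt_bot
    · have h1 := (Endpoint.plus_le_minus_iff s t).1 h.le
      exact ⟨(s + t) / 2, (Endpoint.plus_le_minus_iff _ _).2 (by linarith),
        (Endpoint.plus_le_minus_iff _ _).2 (by linarith)⟩
    · rw [← not_le, Endpoint.plus_le_plus_iff, not_le] at h
      exact ⟨t, (Endpoint.plus_le_minus_iff _ _).2 h, le_rfl⟩
    · exact ⟨s + 1, (Endpoint.plus_le_minus_iff _ _).2 (by linarith), le_top⟩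
  · exact absurd h not_top_lt

/-- An interval of `ℝ`, given by its pair of decorated endpoints `b < d`. By
`RInterval.carrier_injective` and `RInterval.exists_carrier_eq_iff`, these are the same thing as
the nonempty order-connected subsets of `ℝ`. -/
@[ext]
structure RInterval : Type where
  lower : Endpoint
  upper : Endpoint
  lower_lt_upper : lower < upper

/-- The underlying set of an interval. -/
def RInterval.carrier (I : RInterval) : Set ℝ := span I.lower I.upper

theorem RInterval.carrier_injective : Function.Injective RInterval.carrier := by
  have key : ∀ I J : RInterval, I.carrier = J.carrier →
      J.lower ≤ I.lower ∧ I.upper ≤ J.upper := by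
    intro I J h
    obtain ⟨x, hx⟩ := span_nonempty I.lower_lt_upper
    have hxJ : x ∈ J.carrier := h ▸ (show x ∈ I.carrier from hx)
    constructor
    · by_contra hlt
      obtain ⟨t, ht1, ht2⟩ := span_nonempty (not_le.1 hlt)
      have htI : t ∈ I.carrier :=
        ⟨ht1, ht2.trans (hxJ.1.trans ((Endpoint.minus_lt_plus x).le.trans hx.2))⟩
      rw [h] at htI
      exact absurd (ht2.trans htI.1) (not_le.2 (Endpoint.minus_lt_plus t))
    · by_contra hlt
      obtain ⟨t, ht1, ht2⟩ := span_nonempty (not_le.1 hlt)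
      have htI : t ∈ I.carrier :=
        ⟨hx.1.trans ((Endpoint.minus_lt_plus x).le.trans (hxJ.2.trans ht1)), ht2⟩
      rw [h] at htI
      exact absurd (htI.2.trans ht1) (not_le.2 (Endpoint.minus_lt_plus t))
  intro I J h
  exact RInterval.ext (le_antisymm (key J I h.symm).1 (key I J h).1)
    (le_antisymm (key I J h).2 (key J I h.symm).2)

theorem RInterval.exists_carrier_eq_iff (S : Set ℝ) :
    (∃ I : RInterval, I.carrier = S) ↔ S.Nonempty ∧ S.OrdConnected := by
  constructor
  · rintro ⟨I, rfl⟩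
    refine ⟨span_nonempty I.lower_lt_upper, ⟨fun x hx y hy z hz => ⟨?_, ?_⟩⟩⟩
    · exact hx.1.trans ((Endpoint.minus_le_minus_iff _ _).2 hz.1)
    · exact ((Endpoint.plus_le_plus_iff _ _).2 hz.2).trans hy.2
  · rintro ⟨⟨x₀, hx₀⟩, hS⟩
    obtain ⟨b, hb⟩ : ∃ b : Endpoint, ∀ t, b ≤ Endpoint.minus t ↔ ∃ x ∈ S, x ≤ t := by
      by_cases hbd : BddBelow S
      · by_cases hm : sInf S ∈ S
        · refine ⟨Endpoint.minus (sInf S), fun t => ?_⟩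
          rw [Endpoint.minus_le_minus_iff]
          exact ⟨fun h => ⟨_, hm, h⟩, fun ⟨x, hx, h⟩ => (csInf_le hbd hx).trans h⟩
        · refine ⟨Endpoint.plus (sInf S), fun t => ?_⟩
          rw [Endpoint.plus_le_minus_iff]
          constructor
          · intro h
            obtain ⟨x, hx, hxt⟩ := exists_lt_of_csInf_lt ⟨x₀, hx₀⟩ h
            exact ⟨x, hx, hxt.le⟩
          · rintro ⟨x, hx, h⟩
            refine lt_of_lt_of_le (lt_of_le_of_ne (csInf_le hbd hx) ?_) h
            rintro he
            exact hm (he ▸ hx)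
      · refine ⟨⊥, fun t => ⟨fun _ => ?_, fun _ => bot_le⟩⟩
        obtain ⟨x, hx, h⟩ := not_bddBelow_iff.1 hbd t
        exact ⟨x, hx, h.le⟩
    obtain ⟨d, hd⟩ : ∃ d : Endpoint, ∀ t, Endpoint.plus t ≤ d ↔ ∃ y ∈ S, t ≤ y := by
      by_cases hbd : BddAbove S
      · by_cases hm : sSup S ∈ S
        · refine ⟨Endpoint.plus (sSup S), fun t => ?_⟩
          rw [Endpoint.plus_le_plus_iff]
          exact ⟨fun h => ⟨_, hm, h⟩, fun ⟨x, hx, h⟩ => h.trans (le_csSup hbd hx)⟩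
        · refine ⟨Endpoint.minus (sSup S), fun t => ?_⟩
          rw [Endpoint.plus_le_minus_iff]
          constructor
          · intro h
            obtain ⟨x, hx, hxt⟩ := exists_lt_of_lt_csSup ⟨x₀, hx₀⟩ h
            exact ⟨x, hx, hxt.le⟩
          · rintro ⟨x, hx, h⟩
            refine lt_of_le_of_lt h (lt_of_le_of_ne (le_csSup hbd hx) ?_)
            rintro he
            exact hm (he ▸ hx)
      · refine ⟨⊤, fun t => ⟨fun _ => ?_, fun _ => le_top⟩⟩
        obtain ⟨x, hx, h⟩ := not_bddAbove_iff.1 hbd t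
        exact ⟨x, hx, h.le⟩
    refine ⟨⟨b, d, ((hb x₀).2 ⟨x₀, hx₀, le_rfl⟩).trans_lt
      ((Endpoint.minus_lt_plus x₀).trans_le ((hd x₀).2 ⟨x₀, hx₀, le_rfl⟩))⟩, ?_⟩
    ext t
    constructor
    · rintro ⟨h1, h2⟩
      obtain ⟨x, hx, hxt⟩ := (hb t).1 h1
      obtain ⟨y, hy, hty⟩ := (hd t).1 h2
      exact hS.out hx hy ⟨hxt, hty⟩
    · intro ht
      exact ⟨(hb t).2 ⟨t, ht, le_rfl⟩, (hd t).2 ⟨t, ht, le_rfl⟩⟩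

/-! ### Barcodes and `δ`-matchings -/

/-- A barcode: a multiset of intervals of `ℝ`, given by its multiplicity function (all
multiplicities are finite, and the intervals of multiplicity `0` do not occur). -/
def Barcode : Type := RInterval → ℕ

/-- The elements of a barcode: each interval occurs as often as its multiplicity says. -/
def Barcode.Elements (C : Barcode) : Type := Σ I : RInterval, Fin (C I)

/-- A matching between the elements of two barcodes (a bijection between subsets, here a
`PEquiv`, with `J ∈ σ I` if `σ` matches `I` to `J`) is a `δ`-matching if
every interval `⟨b, d⟩` of either barcode with `b + 2δ < d` is matched, and
`⟨b, d⟩ ⊆ ⟨b' - δ, d' + δ⟩` and `⟨b', d'⟩ ⊆ ⟨b - δ, d + δ⟩` whenever `⟨b, d⟩` is matched to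
`⟨b', d'⟩`. -/
structure IsDeltaMatching (δ : ℝ≥0) {C D : Barcode} (σ : C.Elements ≃. D.Elements) : Prop where
  dom : ∀ I : C.Elements, I.1.lower.shift (2 * (δ : ℝ)) < I.1.upper → ∃ J, J ∈ σ I
  im : ∀ J : D.Elements, J.1.lower.shift (2 * (δ : ℝ)) < J.1.upper → ∃ I, J ∈ σ I
  subset_left : ∀ I J, J ∈ σ I →
    I.1.carrier ⊆ span (J.1.lower.shift (-(δ : ℝ))) (J.1.upper.shift (δ : ℝ))
  subset_right : ∀ I J, J ∈ σ I →
    J.1.carrier ⊆ span (I.1.lower.shift (-(δ : ℝ))) (I.1.upper.shift (δ : ℝ))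

/-- There is a `δ`-matching between the barcodes `C` and `D`. -/
def DeltaMatched (δ : ℝ≥0) (C D : Barcode) : Prop :=
  ∃ σ : C.Elements ≃. D.Elements, IsDeltaMatching δ σ

/-- The bottleneck distance, with values in `[0, ∞]` (the infimum of the empty set is `∞`). -/
noncomputable def bottleneckDist (C D : Barcode) : ℝ≥0∞ :=
  ⨅ (δ : ℝ≥0) (_ : DeltaMatched δ C D), (δ : ℝ≥0∞)

/-! ### Persistence modules -/

/-- Persistence modules over `K`: functors from the poset `ℝ` to `K`-vector spaces. -/
abbrev PersistenceModule (K : Type u) [Field K] : Type (u + 1) := ℝ ⥤ ModuleCat.{u} K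

section Modules

variable {K : Type u} [Field K]

/-- Pointwise finite-dimensional persistence modules. -/
def IsPFD (M : PersistenceModule K) : Prop := ∀ t : ℝ, FiniteDimensional K (M.obj t)

/-- The shift functor `M ↦ M(δ)`, where `M(δ)_t = M_{t + δ}`. -/
def shift (δ : ℝ) : PersistenceModule K ⥤ PersistenceModule K :=
  (Functor.whiskeringLeft ℝ ℝ (ModuleCat.{u} K)).obj
    (Monotone.functor (f := fun t : ℝ => t + δ) fun _ _ h => add_le_add_left h δ)

/-- Two persistence modules are `δ`-interleaved if there are morphisms `f : M ⟶ N(δ)` and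
`g : N ⟶ M(δ)` such that `g(δ) ∘ f` and `f(δ) ∘ g` are the `2δ`-transition morphisms of `M` and
`N`, that is, at each `t` they are the transition maps from `t` to `t + δ + δ`. -/
def Interleaved (δ : ℝ≥0) (M N : PersistenceModule K) : Prop :=
  ∃ (f : M ⟶ (shift (δ : ℝ)).obj N) (g : N ⟶ (shift (δ : ℝ)).obj M),
    (∀ t : ℝ, (f ≫ (shift (δ : ℝ)).map g).app t =
      M.map (homOfLE (by linarith [δ.coe_nonneg] : t ≤ t + (δ : ℝ) + (δ : ℝ)))) ∧
    (∀ t : ℝ, (g ≫ (shift (δ : ℝ)).map f).app t =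
      N.map (homOfLE (by linarith [δ.coe_nonneg] : t ≤ t + (δ : ℝ) + (δ : ℝ))))

/-- The interleaving distance, with values in `[0, ∞]` (the infimum of the empty set is `∞`). -/
noncomputable def interleavingDist (M N : PersistenceModule K) : ℝ≥0∞ :=
  ⨅ (δ : ℝ≥0) (_ : Interleaved δ M N), (δ : ℝ≥0∞)

variable (K) in
open scoped Classical in
/-- The value at `t` of the interval persistence module on `I`: all of `K` if `t ∈ I`, and `0`
otherwise. -/
noncomputable def intervalFiber (I : RInterval) (t : ℝ) : Submodule K K :=
  if t ∈ I.carrier then ⊤ else ⊥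

variable (K) in
open scoped Classical in
/-- The transition maps of the interval persistence module on `I`: the identity of `K` if
`s, t ∈ I`, and `0` otherwise. -/
noncomputable def intervalMap (I : RInterval) (s t : ℝ) :
    intervalFiber K I s →ₗ[K] intervalFiber K I t :=
  if h : s ∈ I.carrier ∧ t ∈ I.carrier then
    Submodule.inclusion (by rw [intervalFiber, intervalFiber, if_pos h.2]; exact le_top)
  else 0

theorem coe_intervalMap_of_mem {I : RInterval} {s t : ℝ} (hs : s ∈ I.carrier)
    (ht : t ∈ I.carrier) (x : intervalFiber K I s) : (intervalMap K I s t x : K) = x := by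
  rw [intervalMap, dif_pos ⟨hs, ht⟩]
  rfl

theorem intervalMap_of_not {I : RInterval} {s t : ℝ} (h : ¬ (s ∈ I.carrier ∧ t ∈ I.carrier)) :
    intervalMap K I s t = 0 := by
  rw [intervalMap, dif_neg h]

theorem coe_eq_zero_of_notMem {I : RInterval} {t : ℝ} (ht : t ∉ I.carrier)
    (x : intervalFiber K I t) : x = 0 := by
  have e : intervalFiber K I t = ⊥ := if_neg ht
  exact Subtype.ext ((Submodule.mem_bot K).1 (e.le x.2))

theorem intervalMap_self (I : RInterval) (t : ℝ) : intervalMap K I t t = LinearMap.id := by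
  ext x
  by_cases ht : t ∈ I.carrier
  · exact coe_intervalMap_of_mem ht ht x
  · rw [coe_eq_zero_of_notMem ht x, map_zero, map_zero]

theorem intervalMap_comp (I : RInterval) {r s t : ℝ} (hrs : r ≤ s) (hst : s ≤ t) :
    intervalMap K I s t ∘ₗ intervalMap K I r s = intervalMap K I r t := by
  by_cases h : r ∈ I.carrier ∧ t ∈ I.carrier
  · have hs : s ∈ I.carrier :=
      ((RInterval.exists_carrier_eq_iff _).1 ⟨I, rfl⟩).2.out h.1 h.2 ⟨hrs, hst⟩
    ext x
    rw [LinearMap.comp_apply, coe_intervalMap_of_mem hs h.2, coe_intervalMap_of_mem h.1 hs,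
      coe_intervalMap_of_mem h.1 h.2]
  · rw [intervalMap_of_not h]
    by_cases hr : r ∈ I.carrier
    · rw [intervalMap_of_not (s := s) (t := t) fun h' => h ⟨hr, h'.2⟩, LinearMap.zero_comp]
    · rw [intervalMap_of_not (s := r) (t := s) fun h' => hr h'.1, LinearMap.comp_zero]

variable (K) in
/-- The interval persistence module `C(I)`. -/
noncomputable def intervalModule (I : RInterval) : PersistenceModule K where
  obj t := ModuleCat.of K (intervalFiber K I t)
  map {s t} _ := ModuleCat.ofHom (intervalMap K I s t)
  map_id t := by rw [intervalMap_self]; rfl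
  map_comp {r s t} f g := by
    rw [← intervalMap_comp I (leOfHom f) (leOfHom g)]; rfl

/-- The (pointwise) direct sum of a family of persistence modules. -/
noncomputable def directSum {ι : Type} (M : ι → PersistenceModule K) : PersistenceModule K where
  obj t := ModuleCat.of K (⨁ i, (M i).obj t)
  map f := ModuleCat.ofHom (DirectSum.lmap fun i => ((M i).map f).hom)
  map_id t := by
    simp only [CategoryTheory.Functor.map_id, ModuleCat.hom_id, DirectSum.lmap_id]; rfl
  map_comp f g := by
    simp only [Functor.map_comp, ModuleCat.hom_comp, DirectSum.lmap_comp]; rfl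

/-- `C` is a barcode of `M` if `M ≅ ⨁_{I ∈ C} C(I)`. -/
def IsBarcode (M : PersistenceModule K) (C : Barcode) : Prop :=
  Nonempty (M ≅ directSum fun I : C.Elements => intervalModule K I.1)

open scoped Classical in
/-- The barcode of `M`, with the junk value of the empty barcode if `M` has no barcode. -/
noncomputable def barcode (M : PersistenceModule K) : Barcode :=
  if h : ∃ C, IsBarcode M C then h.choose else fun _ => 0

end Modules

end Persistence

/-! Decomposition. In a nonzero p.f.d. module some interval module splits off (`exists_split_bar`):
a nonzero vector at `t` is extended backwards by coherent preimages and forwards by its images, and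
a coherent family of functionals taking the value 1 on it gives the complement. Zorn's lemma on
partial decompositions then exhausts the module. The argument is carried out inside `M`, with bases
of bars (`IsBarBasis`): families of vectors, each supported on an interval, that form a basis of
every `M_t`. `isBarcode_iff` translates between these and barcodes.

Matching to interleaving. Each bar is sent to its partner, or to zero if unmatched; an unmatched bar
dies under the `2δ`-transition, and a matched one returns to itself.

Interleaving to matching. The morphisms `f` and `g` become matrices over the bars. For a finite set
of bars of `M` longer than `2δ`, only the rows and columns of bars of `N` that can legally be
matched with one of them are kept. When the bars are ordered by their centres, the relevant half of
the product of the two truncated matrices is still that of the identity (`sum_coeff_mul_coeff`): a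
path `I → J → I'` through a discarded `J` forces the centre of `I'` to lie strictly to the left of
that of `I`. Hence there are at least as many neighbours as bars (`card_le_card_of_triangular`),
which is Hall's condition. This gives an injection on the long bars of `M` and, symmetrically, one
on those of `N`; `exists_pequiv_covering` merges them.

Uniqueness of barcodes is a corollary: `M` is 0-interleaved with itself, and a 0-matching pairs
equal intervals. -/

namespace Persistence

universe u

/-! ### Transition maps -/

section Trans

variable {K : Type u} [Field K]

/-- The transition map `M_s → M_t` of a persistence module, as a linear map. -/
def trans (M : PersistenceModule K) {s t : ℝ} (h : s ≤ t) : M.obj s →ₗ[K] M.obj t :=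
  (M.map (homOfLE h)).hom

theorem trans_self (M : PersistenceModule K) {t : ℝ} (h : t ≤ t) (x : M.obj t) :
    trans M h x = x := by
  have e : homOfLE h = 𝟙 t := rfl
  rw [trans, e, M.map_id]
  rfl

theorem trans_trans (M : PersistenceModule K) {r s t : ℝ} (hrs : r ≤ s) (hst : s ≤ t)
    (x : M.obj r) : trans M hst (trans M hrs x) = trans M (hrs.trans hst) x := by
  have e : homOfLE (hrs.trans hst) = homOfLE hrs ≫ homOfLE hst := rfl
  rw [trans, trans, trans, e, M.map_comp]
  rfl

theorem app_trans {M N : PersistenceModule K} (f : M ⟶ N) {s t : ℝ} (h : s ≤ t) (x : M.obj s) :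
    (f.app t).hom (trans M h x) = trans N h ((f.app s).hom x) :=
  congrArg (fun φ => φ.hom x) (f.naturality (homOfLE h))

end Trans

theorem exists_functional_apply_eq_one {K V : Type*} [Field K] [AddCommGroup V] [Module K V]
    {x : V} (hx : x ≠ 0) : ∃ η : V →ₗ[K] K, η x = 1 := by
  obtain ⟨η, hη⟩ : ∃ η : V →ₗ[K] K, η x ≠ 0 := by
    by_contra! h
    exact hx ((Module.forall_dual_apply_eq_zero_iff K x).1 h)
  exact ⟨(η x)⁻¹ • η, by simp [hη]⟩

/-- An element of a directed system which survives to every later stage is detected by a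
compatible family of functionals. -/
theorem exists_compatible_functionals {K ι : Type*} [Field K] [LinearOrder ι] {G : ι → Type*}
    [∀ i, AddCommGroup (G i)] [∀ i, Module K (G i)] (f : ∀ i j, i ≤ j → G i →ₗ[K] G j)
    [DirectedSystem G (f · · ·)] (i₀ : ι) (x : G i₀) (hx : ∀ j h, f i₀ j h x ≠ 0) :
    ∃ η : ∀ i, G i →ₗ[K] K, (∀ i j h y, η j (f i j h y) = η i y) ∧ η i₀ x = 1 := by
  have h0 : Module.DirectLimit.of K ι G f i₀ x ≠ 0 := by
    intro h
    obtain ⟨j, hij, hj⟩ := Module.DirectLimit.of.zero_exact h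
    exact hx j hij hj
  obtain ⟨η, hη⟩ := exists_functional_apply_eq_one (K := K) h0
  refine ⟨fun i => η ∘ₗ Module.DirectLimit.of K ι G f i, fun i j h y => ?_, hη⟩
  rw [LinearMap.comp_apply, LinearMap.comp_apply, Module.DirectLimit.of_f]

/-! ### Splitting off an interval -/

section Split

variable {K : Type u} [Field K]

/-- A compatible family of vectors supported on an interval: a morphism from the interval module
on `I` to `M`. -/
structure Bar (M : PersistenceModule K) where
  I : RInterval
  v : ∀ t, M.obj t
  zero : ∀ t, t ∉ I.carrier → v t = 0
  map : ∀ {s t} (h : s ≤ t), s ∈ I.carrier → trans M h (v s) = v t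

/-- Over the stages where `v` survives, its class in the direct limit is nonzero; a functional on
the limit that is 1 on this class pulls back to every stage. -/
theorem exists_forward_functionals (M : PersistenceModule K) {t : ℝ} {v : M.obj t} (hv : v ≠ 0) :
    ∃ η : ∀ r, M.obj r →ₗ[K] K, η t v = 1 ∧ ∀ r s (hr : t ≤ r) (hrs : r ≤ s) (x : M.obj r),
      trans M (hr.trans hrs) v ≠ 0 → η s (trans M hrs x) = η r x := by
  let ι := {r : ℝ // ∃ h : t ≤ r, trans M h v ≠ 0}
  let f : ∀ i j : ι, i ≤ j → M.obj i.1 →ₗ[K] M.obj j.1 := fun i j h => trans M (Subtype.coe_le_coe.2 h)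
  have : DirectedSystem (fun i : ι => M.obj i.1) (f · · ·) :=
    ⟨fun i x => trans_self M _ x, fun k j i hij hjk x => trans_trans M _ _ x⟩
  obtain ⟨η, h1, h2⟩ := exists_compatible_functionals f ⟨t, le_rfl, by rwa [trans_self]⟩ v
    (fun j h => j.2.2)
  classical
  refine ⟨fun r => if h : ∃ h : t ≤ r, trans M h v ≠ 0 then η ⟨r, h⟩ else 0, ?_, ?_⟩
  · beta_reduce
    rw [dif_pos ⟨le_rfl, by rwa [trans_self]⟩]
    exact h2
  · intro r s hr hrs x hne
    have hr' : trans M hr v ≠ 0 := fun h => hne (by rw [← trans_trans M hr hrs, h, map_zero])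
    beta_reduce
    rw [dif_pos ⟨hr.trans hrs, hne⟩, dif_pos ⟨hr, hr'⟩]
    exact h1 ⟨r, _⟩ ⟨s, _⟩ hrs x

/-- Coherent preimages are a point of an inverse limit. Dualising turns it into a direct limit,
where `exists_compatible_functionals` applies, and finite-dimensionality identifies each bidual with
the space itself. -/
theorem exists_backward_vectors (M : PersistenceModule K) (hM : IsPFD M) (t : ℝ)
    (ht : ∃ x : M.obj t, x ≠ 0) :
    ∃ x : ∀ s, M.obj s, x t ≠ 0 ∧ ∀ r s (hr : r ≤ s) (hs : s ≤ t),
      trans M (hr.trans hs) ≠ 0 → trans M hr (x r) = x s := by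
  have hfd : ∀ t, FiniteDimensional K (M.obj t) := hM
  have htt : trans M (le_refl t) ≠ 0 := by
    obtain ⟨x, hx⟩ := ht
    intro h
    exact hx (by rw [← trans_self M le_rfl x, h]; rfl)
  let ι := {s : ℝ // ∃ h : s ≤ t, trans M h ≠ 0}
  -- The images in `M_t` decrease as `s` does, so one of least rank is contained in all the others.
  -- A functional that is nonzero on it is therefore never killed in the dual system.
  obtain ⟨s₀, hs₀⟩ : ∃ s₀ : ι, ∀ s : ι, Module.finrank K (LinearMap.range (trans M s₀.2.1)) ≤
      Module.finrank K (LinearMap.range (trans M s.2.1)) := by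
    have : Nonempty ι := ⟨⟨t, le_rfl, htt⟩⟩
    let F : ι → ℕ := fun s => Module.finrank K (LinearMap.range (trans M s.2.1))
    exact ⟨Function.argmin F, fun s => Function.argmin_le F s⟩
  have hmono : ∀ r s : ι, r ≤ s →
      LinearMap.range (trans M r.2.1) ≤ LinearMap.range (trans M s.2.1) := by
    rintro r s h _ ⟨y, rfl⟩
    exact ⟨trans M (Subtype.coe_le_coe.2 h) y, trans_trans M _ _ _⟩
  have hle : ∀ s : ι, LinearMap.range (trans M s₀.2.1) ≤ LinearMap.range (trans M s.2.1) := by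
    intro s
    rcases le_total s₀ s with h | h
    · exact hmono _ _ h
    · exact (Submodule.eq_of_le_of_finrank_le (hmono _ _ h) (hs₀ s)).ge
  obtain ⟨a, ha⟩ : ∃ a, trans M s₀.2.1 a ≠ 0 := by
    by_contra! h
    exact s₀.2.2 (LinearMap.ext h)
  obtain ⟨ξ, hξ⟩ := exists_functional_apply_eq_one (K := K) ha
  let G : ιᵒᵈ → Type u := fun s => Module.Dual K (M.obj (OrderDual.ofDual s).1)
  let f : ∀ i j : ιᵒᵈ, i ≤ j → G i →ₗ[K] G j := fun i j h =>
    (trans M (show (OrderDual.ofDual j).1 ≤ (OrderDual.ofDual i).1 from h)).dualMap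
  have : DirectedSystem G (f · · ·) :=
    ⟨fun i x => LinearMap.ext fun y => congrArg x (trans_self M _ y),
      fun k j i hij hjk x => LinearMap.ext fun y => congrArg x (trans_trans M _ _ y)⟩
  obtain ⟨η, h1, h2⟩ := exists_compatible_functionals f (OrderDual.toDual ⟨t, le_rfl, htt⟩) ξ
    (by
      intro j h h0
      obtain ⟨y, hy⟩ := hle (OrderDual.ofDual j) ⟨a, rfl⟩
      have := LinearMap.congr_fun h0 y
      change ξ (trans M _ y) = 0 at this
      rw [hy, hξ] at this
      exact one_ne_zero this)
  let y : ∀ s : ι, M.obj s.1 := fun s => (Module.evalEquiv K (M.obj s.1)).symm (η (OrderDual.toDual s))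
  have hy : ∀ (s : ι) (ζ : Module.Dual K (M.obj s.1)), ζ (y s) = η (OrderDual.toDual s) ζ := by
    intro s ζ
    have := (Module.evalEquiv K (M.obj s.1)).apply_symm_apply (η (OrderDual.toDual s))
    exact LinearMap.congr_fun this ζ
  classical
  refine ⟨fun s => if h : ∃ h : s ≤ t, trans M h ≠ 0 then y ⟨s, h⟩ else 0, ?_, ?_⟩
  · beta_reduce
    rw [dif_pos ⟨le_rfl, htt⟩]
    intro h0
    have := hy ⟨t, le_rfl, htt⟩ ξ
    rw [h0, map_zero, h2] at this
    exact zero_ne_one this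
  · intro r s hr hs hne
    have hne' : trans M hs ≠ 0 := by
      intro h
      apply hne
      ext z
      rw [← trans_trans M hr hs, h]
      rfl
    beta_reduce
    rw [dif_pos ⟨hr.trans hs, hne⟩, dif_pos ⟨hs, hne'⟩]
    rw [← sub_eq_zero, ← Module.forall_dual_apply_eq_zero_iff K]
    intro ζ
    rw [map_sub, sub_eq_zero, hy ⟨s, hs, hne'⟩ ζ,
      ← h1 (OrderDual.toDual ⟨s, hs, hne'⟩) (OrderDual.toDual ⟨r, hr.trans hs, hne⟩) hr ζ]
    exact hy ⟨r, hr.trans hs, hne⟩ (ζ ∘ₗ trans M hr)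

/-- A nonzero pointwise finite-dimensional persistence module has a direct summand which is an
interval module. -/
theorem exists_split_bar (M : PersistenceModule K) (hM : IsPFD M) (t : ℝ)
    (ht : ∃ x : M.obj t, x ≠ 0) :
    ∃ (b : Bar M) (ξ : ∀ s, M.obj s →ₗ[K] K),
      (∀ s, s ∉ b.I.carrier → ξ s = 0) ∧
      (∀ {r s} (h : r ≤ s) (x : M.obj r), s ∈ b.I.carrier → ξ s (trans M h x) = ξ r x) ∧
      ∀ s, s ∈ b.I.carrier → ξ s (b.v s) = 1 := by
  obtain ⟨x, hx, hxmap⟩ := exists_backward_vectors M hM t ht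
  obtain ⟨η, hη, hηmap⟩ := exists_forward_functionals M hx
  have htt : trans M (le_refl t) ≠ 0 := by
    intro h
    exact hx (by rw [← trans_self M le_rfl (x t), h]; rfl)
  -- Below `t` the bar lives as long as the map to `M_t` is nonzero, not merely while `x t` has a
  -- preimage. This makes the functionals `η t ∘ trans` vanish off `S`.
  let S : Set ℝ := {s | (∃ h : s ≤ t, trans M h ≠ 0) ∨ ∃ h : t ≤ s, trans M h (x t) ≠ 0}
  have hlow : ∀ {r s} (hrs : r ≤ s) (hs : s ≤ t), trans M (hrs.trans hs) ≠ 0 → trans M hs ≠ 0 := by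
    intro r s hrs hs hne h
    apply hne
    ext z
    rw [← trans_trans M hrs hs, h]
    rfl
  have hup : ∀ {r s} (hr : t ≤ r) (hrs : r ≤ s), trans M (hr.trans hrs) (x t) ≠ 0 →
      trans M hr (x t) ≠ 0 := fun hr hrs hne h =>
    hne (by rw [← trans_trans M hr hrs, h, map_zero])
  have hSlow : ∀ {s} (h : s ≤ t), s ∈ S → trans M h ≠ 0 := by
    rintro s h (⟨_, h'⟩ | ⟨h', _⟩)
    · exact h'
    · obtain rfl := le_antisymm h h'
      exact htt
  have hSup : ∀ {s} (h : t ≤ s), s ∈ S → trans M h (x t) ≠ 0 := by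
    rintro s h (⟨h', _⟩ | ⟨_, h'⟩)
    · obtain rfl := le_antisymm h h'
      rwa [trans_self]
    · exact h'
  have hS : S.OrdConnected := by
    refine ⟨fun r hr s hs z hz => ?_⟩
    rcases le_total z t with h | h
    · exact Or.inl ⟨h, hlow hz.1 h (hSlow _ hr)⟩
    · exact Or.inr ⟨h, hup h hz.2 (hSup _ hs)⟩
  obtain ⟨I, hI⟩ := (RInterval.exists_carrier_eq_iff S).2 ⟨⟨t, Or.inl ⟨le_rfl, htt⟩⟩, hS⟩
  classical
  -- Below `t` the vector has to be cut off by hand outside `S`, while above `t` the image of `x t`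
  -- vanishes there by itself. For `ξ` below, the two sides exchange roles.
  let v : ∀ s, M.obj s := fun s =>
    if h : s ≤ t then (if trans M h ≠ 0 then x s else 0)
    else trans M (not_le.1 h).le (x t)
  have hvlow : ∀ {s} (h : s ≤ t), s ∈ S → v s = x s := fun h hs => by
    simp only [v]; rw [dif_pos h, if_pos (hSlow h hs)]
  have hvup : ∀ {s} (h : t ≤ s), v s = trans M h (x t) := by
    intro s h
    by_cases h' : s ≤ t
    · obtain rfl := le_antisymm h h'
      rw [hvlow le_rfl (Or.inl ⟨le_rfl, htt⟩), trans_self]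
    · simp only [v]; rw [dif_neg h']
  let ξ : ∀ s, M.obj s →ₗ[K] K := fun s =>
    if h : s ≤ t then η t ∘ₗ trans M h
    else if trans M (not_le.1 h).le (x t) ≠ 0 then η s else 0
  have hξlow : ∀ {s} (h : s ≤ t) (y), ξ s y = η t (trans M h y) := fun h y => by
    simp only [ξ]; rw [dif_pos h]; rfl
  have hξup : ∀ {s} (h : t ≤ s), s ∈ S → ξ s = η s := by
    intro s h hs
    by_cases h' : s ≤ t
    · obtain rfl := le_antisymm h h'
      ext y
      rw [hξlow le_rfl, trans_self]
    · simp only [ξ]; rw [dif_neg h', if_pos (hSup _ hs)]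
  refine ⟨⟨I, v, ?_, ?_⟩, ξ, ?_, ?_, ?_⟩
  · intro s hs
    rw [hI] at hs
    by_cases h : s ≤ t
    · simp only [v]
      rw [dif_pos h, if_neg fun h' => hs (Or.inl ⟨h, h'⟩)]
    · rw [hvup (not_le.1 h).le]
      by_contra h'
      exact hs (Or.inr ⟨_, h'⟩)
  · intro r s h hr
    rw [hI] at hr
    rcases le_total t r with h' | h'
    · rw [hvup h', hvup (h'.trans h), trans_trans]
    · rw [hvlow h' hr]
      rcases le_total s t with h'' | h''
      · rw [hvlow h'' (Or.inl ⟨h'', hlow h h'' (hSlow _ hr)⟩)]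
        exact hxmap r s h h'' (hSlow _ hr)
      · rw [hvup h'', ← hxmap r t h' le_rfl (hSlow _ hr), trans_trans]
  · intro s hs
    change s ∉ I.carrier at hs
    rw [hI] at hs
    by_cases h : s ≤ t
    · simp only [ξ]
      rw [dif_pos h]
      have : trans M h = 0 := by
        by_contra h'
        exact hs (Or.inl ⟨h, h'⟩)
      rw [this, LinearMap.comp_zero]
    · simp only [ξ]
      rw [dif_neg h, if_neg fun h' => hs (Or.inr ⟨_, h'⟩)]
  · intro r s h y hs
    change s ∈ I.carrier at hs
    rw [hI] at hs
    rcases le_total s t with h' | h'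
    · rw [hξlow h', hξlow (h.trans h'), trans_trans]
    · rw [hξup h' hs]
      rcases le_total t r with h'' | h''
      · rw [hξup h'' (Or.inr ⟨h'', hup h'' h (hSup _ hs)⟩)]
        exact hηmap r s h'' h y (hSup _ hs)
      · rw [hξlow h'', ← hηmap t s le_rfl h' _ (hSup _ hs), trans_trans]
  · intro s hs
    change s ∈ I.carrier at hs
    change ξ s (v s) = 1
    rw [hI] at hs
    rcases le_total s t with h | h
    · rw [hξlow h, hvlow h hs, hxmap s t h le_rfl (hSlow _ hs), hη]
    · rw [hξup h hs, hvup h, hηmap t s le_rfl h _ (hSup _ hs), hη]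

end Split

/-! ### Decomposition into intervals -/

section Decomposition

variable {K : Type u} [Field K]

/-- The persistence submodule given by a family of subspaces stable under the transition maps. -/
def submoduleFunctor (M : PersistenceModule K) (W : ∀ t, Submodule K (M.obj t))
    (hW : ∀ {s t} (h : s ≤ t) (x : M.obj s), x ∈ W s → trans M h x ∈ W t) :
    PersistenceModule K where
  obj t := ModuleCat.of K (W t)
  map f := ModuleCat.ofHom ((trans M (leOfHom f)).restrict (hW (leOfHom f)))
  map_id t := ModuleCat.hom_ext <| LinearMap.ext fun x : W t =>
    Subtype.ext (trans_self M le_rfl x.1)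
  map_comp {r _ _} f g := ModuleCat.hom_ext <| LinearMap.ext fun x : W r =>
    Subtype.ext (trans_trans M (leOfHom f) (leOfHom g) x.1).symm

/-- This is `exists_split_bar` applied to the submodule `W`, with `W'` the kernel of the functionals
`ξ`. Since `ξ` is 1 on the bar, `y ↦ ξ y • v` is a projection onto its span. -/
theorem exists_split_bar_submodule (M : PersistenceModule K) (hM : IsPFD M)
    (W : ∀ t, Submodule K (M.obj t))
    (hW : ∀ {s t} (h : s ≤ t) (x : M.obj s), x ∈ W s → trans M h x ∈ W t)
    {t : ℝ} (ht : W t ≠ ⊥) :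
    ∃ (b : Bar M) (W' : ∀ t, Submodule K (M.obj t)),
      (∀ {s t} (h : s ≤ t) (x : M.obj s), x ∈ W' s → trans M h x ∈ W' t) ∧
      (∀ s, W' s ≤ W s) ∧ (∀ s, b.v s ∈ W s) ∧ (∀ s, s ∉ b.I.carrier → W' s = W s) ∧
      (∀ s, s ∈ b.I.carrier → b.v s ∉ W' s ∧ W s ≤ Submodule.span K {b.v s} ⊔ W' s) ∧
      b.I.carrier.Nonempty := by
  have hfd : ∀ t, FiniteDimensional K (M.obj t) := hM
  obtain ⟨x, hxW, hx⟩ := (Submodule.ne_bot_iff _).1 ht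
  obtain ⟨b, ξ, h0, hmap, hone⟩ := exists_split_bar (submoduleFunctor M W hW)
    (fun s => inferInstanceAs (FiniteDimensional K (W s))) t
    ⟨(⟨x, hxW⟩ : W t), fun h => hx (congrArg Subtype.val h)⟩
  let ξ' : ∀ s, W s →ₗ[K] K := ξ
  let v' : ∀ s, W s := b.v
  refine ⟨⟨b.I, fun s => (v' s).1, fun s hs => congrArg Subtype.val (b.zero s hs),
    fun h hs => congrArg Subtype.val (b.map h hs)⟩,
    fun s => (LinearMap.ker (ξ' s)).map (W s).subtype, ?_, ?_, ?_, ?_, ?_, ?_⟩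
  · rintro r s h _ ⟨y, hy, rfl⟩
    refine ⟨⟨trans M h y.1, hW h _ y.2⟩, ?_, rfl⟩
    change ξ s (trans (submoduleFunctor M W hW) h y) = 0
    by_cases hs : s ∈ b.I.carrier
    · rw [hmap h y hs]
      exact hy
    · rw [h0 s hs]
      rfl
  · exact fun s => Submodule.map_subtype_le _ _
  · exact fun s => (v' s).2
  · intro s hs
    change (LinearMap.ker (ξ s)).map (W s).subtype = W s
    rw [h0 s hs, LinearMap.ker_zero]
    exact Submodule.map_subtype_top _
  · intro s hs
    have h1 : ξ' s (v' s) = 1 := hone s hs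
    constructor
    · rintro ⟨y, hy, hyv⟩
      rw [← Subtype.ext (a2 := v' s) hyv, LinearMap.mem_ker.1 hy] at h1
      exact zero_ne_one h1
    · intro y hy
      refine Submodule.mem_sup.2 ⟨ξ' s ⟨y, hy⟩ • (v' s).1,
        Submodule.smul_mem _ _ (Submodule.mem_span_singleton_self _),
        y - ξ' s ⟨y, hy⟩ • (v' s).1, ?_, add_sub_cancel _ _⟩
      refine ⟨⟨y, hy⟩ - ξ' s ⟨y, hy⟩ • v' s, ?_, rfl⟩
      change ξ' s (⟨y, hy⟩ - ξ' s ⟨y, hy⟩ • v' s) = 0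
      rw [map_sub, map_smul, h1, smul_eq_mul, mul_one, sub_self]
  · exact span_nonempty b.I.lower_lt_upper

/-- A partial decomposition of a persistence module: a set of bars, and a persistence submodule
complementary to their span. -/
structure BarSplitting (M : PersistenceModule K) where
  S : Set (Bar M)
  W : ∀ t, Submodule K (M.obj t)
  stable : ∀ {s t} (h : s ≤ t) (x : M.obj s), x ∈ W s → trans M h x ∈ W t
  indep : ∀ t, LinearIndepOn K (fun b : Bar M => b.v t) {b | b ∈ S ∧ t ∈ b.I.carrier}
  isCompl : ∀ t, IsCompl
    (Submodule.span K ((fun b : Bar M => b.v t) '' {b | b ∈ S ∧ t ∈ b.I.carrier})) (W t)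

/-- The order on partial decompositions by refinement of the complement. -/
def BarSplitting.LE {M : PersistenceModule K} (A B : BarSplitting M) : Prop :=
  -- The last condition keeps new bars inside the old complement; it is what makes a chain stabilise
  -- at each `t`.
  A.S ⊆ B.S ∧ (∀ t, B.W t ≤ A.W t) ∧ ∀ b ∈ B.S, b ∉ A.S → ∀ t, b.v t ∈ A.W t

theorem BarSplitting.LE.trans {M : PersistenceModule K} {A B C : BarSplitting M} (h : A.LE B)
    (h' : B.LE C) : A.LE C := by
  refine ⟨h.1.trans h'.1, fun t => (h'.2.1 t).trans (h.2.1 t), fun b hb hbA t => ?_⟩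
  by_cases hbB : b ∈ B.S
  · exact h.2.2 b hbB hbA t
  · exact h.2.1 t (h'.2.2 b hb hbB t)

/-- The bound is the union of the bars with the intersection of the complements. All its axioms are
pointwise, and at a given `t` it agrees with a single member of the chain, one whose complement at
`t` has least dimension. -/
theorem BarSplitting.exists_upperBound {M : PersistenceModule K} (hM : IsPFD M)
    (c : Set (BarSplitting M)) (hc : IsChain BarSplitting.LE c) :
    ∃ U : BarSplitting M, ∀ A ∈ c, A.LE U := by
  have hfd : ∀ t, FiniteDimensional K (M.obj t) := hM
  rcases c.eq_empty_or_nonempty with rfl | hne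
  · refine ⟨⟨∅, fun _ => ⊤, fun _ _ _ => trivial, fun t => ?_, fun t => ?_⟩, fun A hA => hA.elim⟩
    · simp only [Set.mem_empty_iff_false, false_and, Set.ofPred_false]
      exact linearIndepOn_empty K _
    · simp only [Set.mem_empty_iff_false, false_and, Set.ofPred_false, Set.image_empty,
        Submodule.span_empty]
      exact isCompl_bot_top
  have htot : ∀ A ∈ c, ∀ B ∈ c, A.LE B ∨ B.LE A := by
    intro A hA B hB
    by_cases h : A = B
    · subst h
      exact Or.inl ⟨subset_rfl, fun _ => le_rfl, fun b hb hb' => absurd hb hb'⟩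
    · exact hc hA hB h
  have key : ∀ t, ∃ A ∈ c, (∀ B ∈ c, A.W t ≤ B.W t) ∧
      {b : Bar M | b ∈ (⋃ B ∈ c, B.S) ∧ t ∈ b.I.carrier} = {b | b ∈ A.S ∧ t ∈ b.I.carrier} := by
    intro t
    have : Nonempty c := hne.to_subtype
    let F : c → ℕ := fun A => Module.finrank K (A.1.W t)
    obtain ⟨⟨A, hA⟩, hmin⟩ : ∃ A : c, ∀ B : c, F A ≤ F B := ⟨_, fun B => Function.argmin_le F B⟩
    have hle : ∀ B ∈ c, A.W t ≤ B.W t := by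
      intro B hB
      rcases htot A hA B hB with h | h
      · exact (Submodule.eq_of_le_of_finrank_le (h.2.1 t) (hmin ⟨B, hB⟩)).ge
      · exact h.2.1 t
    refine ⟨A, hA, hle, Set.ext fun b => ⟨?_, ?_⟩⟩
    · rintro ⟨hb, hbt⟩
      refine ⟨?_, hbt⟩
      obtain ⟨B, hB, hbB⟩ := Set.mem_iUnion₂.1 hb
      by_contra hbA
      rcases htot A hA B hB with h | h
      -- A bar of `B` alive at `t` and missing from `A` would lie both in the complement of `B` and
      -- in the span of its bars, hence be zero.
      · have h1 : b.v t ∈ B.W t := hle B hB (h.2.2 b hbB hbA t)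
        have h2 : b.v t ∈ Submodule.span K
            ((fun b : Bar M => b.v t) '' {b | b ∈ B.S ∧ t ∈ b.I.carrier}) :=
          Submodule.subset_span ⟨b, ⟨hbB, hbt⟩, rfl⟩
        exact (B.indep t).ne_zero ⟨hbB, hbt⟩ (Submodule.disjoint_def.1 (B.isCompl t).disjoint _ h2 h1)
      · exact hbA (h.1 hbB)
    · rintro ⟨hb, hbt⟩
      exact ⟨Set.mem_biUnion hA hb, hbt⟩
  have hW : ∀ t, ∀ A ∈ c, (∀ B ∈ c, A.W t ≤ B.W t) → ⨅ B ∈ c, B.W t = A.W t := fun t A hA h =>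
    le_antisymm (iInf₂_le A hA) (le_iInf₂ h)
  refine ⟨⟨⋃ B ∈ c, B.S, fun t => ⨅ B ∈ c, B.W t, fun {s t} h x hx => ?_, fun t => ?_, fun t => ?_⟩,
    fun A hA => ⟨Set.subset_biUnion_of_mem (u := fun B : BarSplitting M => B.S) hA,
      fun t => iInf₂_le A hA, fun b hb hbA t => ?_⟩⟩
  · simp only [Submodule.mem_iInf] at hx ⊢
    exact fun B hB => B.stable h x (hx B hB)
  · obtain ⟨A, hA, -, hS⟩ := key t
    rw [hS]
    exact A.indep t
  · obtain ⟨A, hA, hle, hS⟩ := key t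
    rw [hS, hW t A hA hle]
    exact A.isCompl t
  · obtain ⟨B, hB, hbB⟩ := Set.mem_iUnion₂.1 hb
    rcases htot A hA B hB with h | h
    · exact h.2.2 b hbB hbA t
    · exact absurd (h.1 hbB) hbA

theorem BarSplitting.exists_extension {M : PersistenceModule K} (hM : IsPFD M)
    (A : BarSplitting M) {t : ℝ} (ht : A.W t ≠ ⊥) :
    ∃ B : BarSplitting M, A.LE B ∧ ¬ B.LE A := by
  obtain ⟨b, W', hW', hle, hbW, hout, hin, s₀, hs₀⟩ :=
    exists_split_bar_submodule M hM A.W A.stable ht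
  have hspan : ∀ s, s ∈ b.I.carrier → b.v s ∉ Submodule.span K
      ((fun b : Bar M => b.v s) '' {b | b ∈ A.S ∧ s ∈ b.I.carrier}) := by
    intro s hs h
    have h0 := Submodule.disjoint_def.1 (A.isCompl s).disjoint _ h (hbW s)
    exact (hin s hs).1 (h0 ▸ Submodule.zero_mem _)
  have hbS : b ∉ A.S := fun h => hspan s₀ hs₀ (Submodule.subset_span ⟨b, ⟨h, hs₀⟩, rfl⟩)
  have hset : ∀ s, s ∈ b.I.carrier → {b' : Bar M | b' ∈ insert b A.S ∧ s ∈ b'.I.carrier} =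
      insert b {b' | b' ∈ A.S ∧ s ∈ b'.I.carrier} := by
    intro s hs
    ext b'
    simp only [Set.mem_ofPred_eq, Set.mem_insert_iff]
    constructor
    · rintro ⟨rfl | h, h'⟩
      · exact Or.inl rfl
      · exact Or.inr ⟨h, h'⟩
    · rintro (rfl | ⟨h, h'⟩)
      · exact ⟨Or.inl rfl, hs⟩
      · exact ⟨Or.inr h, h'⟩
  have hset' : ∀ s, s ∉ b.I.carrier → {b' : Bar M | b' ∈ insert b A.S ∧ s ∈ b'.I.carrier} =
      {b' | b' ∈ A.S ∧ s ∈ b'.I.carrier} := by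
    intro s hs
    ext b'
    simp only [Set.mem_ofPred_eq, Set.mem_insert_iff]
    constructor
    · rintro ⟨rfl | h, h'⟩
      · exact absurd h' hs
      · exact ⟨h, h'⟩
    · rintro ⟨h, h'⟩
      exact ⟨Or.inr h, h'⟩
  refine ⟨⟨insert b A.S, W', hW', fun s => ?_, fun s => ?_⟩,
    ⟨Set.subset_insert _ _, hle, ?_⟩, fun h => hbS (h.1 (Set.mem_insert _ _))⟩
  · by_cases hs : s ∈ b.I.carrier
    · rw [hset s hs]
      exact (A.indep s).insert (hspan s hs)
    · rw [hset' s hs]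
      exact A.indep s
  · by_cases hs : s ∈ b.I.carrier
    · rw [hset s hs, Set.image_insert_eq, Submodule.span_insert]
      refine IsCompl.of_eq ?_ ?_
      · rw [Submodule.eq_bot_iff]
        rintro x ⟨hx, hxW⟩
        obtain ⟨y, hy, z, hz, rfl⟩ := Submodule.mem_sup.1 hx
        obtain ⟨a, rfl⟩ := Submodule.mem_span_singleton.1 hy
        have hzW : z ∈ A.W s := by
          have := Submodule.sub_mem _ (hle s hxW) (Submodule.smul_mem _ a (hbW s))
          rwa [add_sub_cancel_left] at this
        have hz0 := Submodule.disjoint_def.1 (A.isCompl s).disjoint _ hz hzW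
        rw [hz0, add_zero] at hxW ⊢
        by_contra hne
        have ha : a ≠ 0 := fun h => hne (by rw [h, zero_smul])
        exact (hin s hs).1 ((Submodule.smul_mem_iff _ ha).1 hxW)
      · refine top_le_iff.1 ((A.isCompl s).codisjoint.eq_top.ge.trans ?_)
        refine sup_le (le_sup_right.trans le_sup_left) ((hin s hs).2.trans ?_)
        exact sup_le_sup_right le_sup_left _
    · rw [hset' s hs, hout s hs]
      exact A.isCompl s
  · rintro b' (rfl | h) hb' s
    · exact hbW s
    · exact absurd h hb'

/-- A family of bars of `M` is a basis of `M` if at each `t` the vectors of those bars which are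
alive at `t` form a basis of `M_t`. -/
def IsBarBasis {M : PersistenceModule K} {ι : Type*} (b : ι → Bar M) : Prop :=
  ∀ t, LinearIndepOn K (fun i => (b i).v t) {i | t ∈ (b i).I.carrier} ∧
    ⊤ ≤ Submodule.span K ((fun i => (b i).v t) '' {i | t ∈ (b i).I.carrier})

/-- Every pointwise finite-dimensional persistence module has a basis consisting of bars. -/
theorem exists_isBarBasis (M : PersistenceModule K) (hM : IsPFD M) :
    ∃ S : Set (Bar M), IsBarBasis (fun b : S => b.1) := by
  obtain ⟨A, hA⟩ := exists_maximal_of_chains_bounded (BarSplitting.exists_upperBound hM)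
    (fun h h' => h.trans h')
  have hW : ∀ t, A.W t = ⊥ := by
    intro t
    by_contra ht
    obtain ⟨B, hAB, hBA⟩ := A.exists_extension hM ht
    exact hBA (hA B hAB)
  have himg : ∀ t, {b : Bar M | b ∈ A.S ∧ t ∈ b.I.carrier} =
      Subtype.val '' {b : A.S | t ∈ b.1.I.carrier} := by
    intro t
    ext b
    simp [and_comm]
  refine ⟨A.S, fun t => ⟨?_, ?_⟩⟩
  · have := A.indep t
    rw [himg] at this
    exact this.comp_of_image Subtype.val_injective.injOn
  · have := (A.isCompl t).codisjoint.eq_top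
    rw [hW, sup_bot_eq, himg, Set.image_image] at this
    exact this.ge

end Decomposition

/-! ### Bases of bars -/

section BarBasis

variable {K : Type u} [Field K] {M N : PersistenceModule K} {ι : Type*} {b : ι → Bar M}

/-- The basis of `M_t` given by a basis of bars. -/
noncomputable def IsBarBasis.basisAt (hb : IsBarBasis b) (t : ℝ) :
    Module.Basis {i | t ∈ (b i).I.carrier} K (M.obj t) :=
  Module.Basis.mk (hb t).1 (by simpa only [Set.image_eq_range] using (hb t).2)

theorem IsBarBasis.basisAt_apply (hb : IsBarBasis b) (t : ℝ) (i : {i | t ∈ (b i).I.carrier}) :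
    hb.basisAt t i = (b i).v t := Module.Basis.mk_apply _ _ _

theorem IsBarBasis.ext (hb : IsBarBasis b) {t : ℝ} {V : Type*} [AddCommGroup V] [Module K V]
    {φ ψ : M.obj t →ₗ[K] V} (h : ∀ i, t ∈ (b i).I.carrier → φ ((b i).v t) = ψ ((b i).v t)) :
    φ = ψ :=
  (hb.basisAt t).ext fun i => by simpa only [hb.basisAt_apply] using h i.1 i.2

theorem IsBarBasis.finite (hb : IsBarBasis b) (hM : IsPFD M) (t : ℝ) :
    {i | t ∈ (b i).I.carrier}.Finite := by
  have := hM t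
  exact Module.Finite.finite_basis (hb.basisAt t)

open scoped Classical in
/-- The coordinate of a basis of bars, as a functional on `M_t`; it vanishes where the bar is not
alive. -/
noncomputable def IsBarBasis.coord (hb : IsBarBasis b) (i : ι) (t : ℝ) : M.obj t →ₗ[K] K :=
  if h : t ∈ (b i).I.carrier then (hb.basisAt t).coord ⟨i, h⟩ else 0

theorem IsBarBasis.coord_of_notMem (hb : IsBarBasis b) {i : ι} {t : ℝ}
    (h : t ∉ (b i).I.carrier) : hb.coord i t = 0 := dif_neg h

theorem IsBarBasis.coord_self (hb : IsBarBasis b) {i : ι} {t : ℝ} (h : t ∈ (b i).I.carrier) :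
    hb.coord i t ((b i).v t) = 1 := by
  rw [IsBarBasis.coord, dif_pos h, ← hb.basisAt_apply t ⟨i, h⟩, Module.Basis.coord_apply,
    Module.Basis.repr_self, Finsupp.single_eq_same]

theorem IsBarBasis.coord_of_ne (hb : IsBarBasis b) {i j : ι} (hij : i ≠ j) (t : ℝ) :
    hb.coord i t ((b j).v t) = 0 := by
  by_cases h : t ∈ (b i).I.carrier
  · by_cases h' : t ∈ (b j).I.carrier
    · rw [IsBarBasis.coord, dif_pos h, ← hb.basisAt_apply t ⟨j, h'⟩, Module.Basis.coord_apply,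
        Module.Basis.repr_self, Finsupp.single_eq_of_ne]
      exact fun e => hij (congrArg Subtype.val e)
    · rw [(b j).zero t h', map_zero]
  · rw [hb.coord_of_notMem h]
    rfl

/-- Only the later time has to lie in the interval. If `s` does not, bar `i` is not among those
alive at `s`, and both sides are zero. -/
theorem IsBarBasis.coord_trans (hb : IsBarBasis b) {i : ι} {s t : ℝ} (h : s ≤ t)
    (ht : t ∈ (b i).I.carrier) (x : M.obj s) : hb.coord i t (trans M h x) = hb.coord i s x := by
  suffices hb.coord i t ∘ₗ trans M h = hb.coord i s from LinearMap.congr_fun this x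
  refine hb.ext fun j hj => ?_
  rw [LinearMap.comp_apply, (b j).map h hj]
  by_cases hij : i = j
  · subst hij
    rw [hb.coord_self ht, hb.coord_self hj]
  · rw [hb.coord_of_ne hij, hb.coord_of_ne hij]

/-- Expansion of a functional along a basis of bars. -/
theorem IsBarBasis.apply_eq_sum (hb : IsBarBasis b) (hM : IsPFD M) {t : ℝ} (φ : M.obj t →ₗ[K] K)
    (x : M.obj t) (T : Finset ι)
    (hT : ∀ i ∉ T, t ∈ (b i).I.carrier → hb.coord i t x * φ ((b i).v t) = 0) :
    φ x = ∑ i ∈ T, hb.coord i t x * φ ((b i).v t) := by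
  classical
  have hfin := hb.finite hM t
  have hsum : ∀ y : M.obj t, φ y = ∑ i ∈ hfin.toFinset, hb.coord i t y * φ ((b i).v t) := by
    intro y
    suffices φ = ∑ i ∈ hfin.toFinset, (φ ((b i).v t)) • hb.coord i t by
      conv_lhs => rw [this]
      simp [mul_comm]
    refine hb.ext fun j hj => ?_
    rw [LinearMap.sum_apply, Finset.sum_eq_single j]
    · rw [LinearMap.smul_apply, hb.coord_self hj, smul_eq_mul, mul_one]
    · intro i _ hij
      rw [LinearMap.smul_apply, hb.coord_of_ne hij, smul_zero]
    · intro h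
      exact absurd (hfin.mem_toFinset.2 hj) h
  rw [hsum x]
  have h1 : ∀ i ∉ hfin.toFinset, hb.coord i t x * φ ((b i).v t) = 0 := by
    intro i hi
    rw [(b i).zero t fun h => hi (hfin.mem_toFinset.2 h), map_zero, mul_zero]
  have h2 : ∀ i ∉ T, hb.coord i t x * φ ((b i).v t) = 0 := by
    intro i hi
    by_cases h : t ∈ (b i).I.carrier
    · exact hT i hi h
    · exact h1 i fun h' => h (hfin.mem_toFinset.1 h')
  rw [Finset.sum_subset (Finset.subset_union_left (s₂ := T)) fun i _ hi => h1 i hi,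
    Finset.sum_subset (Finset.subset_union_right (s₁ := hfin.toFinset)) fun i _ hi => h2 i hi]

theorem IsBarBasis.exists_hom (hb : IsBarBasis b) (w : ι → Bar N) (hw : ∀ i, (w i).I = (b i).I) :
    ∃ f : M ⟶ N, ∀ i t, (f.app t).hom ((b i).v t) = (w i).v t := by
  let F : ∀ t, M.obj t →ₗ[K] N.obj t := fun t => (hb.basisAt t).constr K fun i => (w i).v t
  have hF : ∀ i t, F t ((b i).v t) = (w i).v t := by
    intro i t
    by_cases h : t ∈ (b i).I.carrier
    · simp only [F]
      rw [← hb.basisAt_apply t ⟨i, h⟩, Module.Basis.constr_basis]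
    · rw [(b i).zero t h, map_zero, (w i).zero t (by rwa [hw i])]
  refine ⟨{ app := fun t => ModuleCat.ofHom (F t), naturality := fun s t f => ?_ }, hF⟩
  refine ModuleCat.hom_ext (hb.ext fun i hi => ?_)
  change F t (trans M (leOfHom f) ((b i).v s)) = trans N (leOfHom f) (F s ((b i).v s))
  rw [(b i).map _ hi, hF, hF, (w i).map _ (by rwa [hw i])]

theorem IsBarBasis.nonempty_iso (hb : IsBarBasis b) {b' : ι → Bar N} (hb' : IsBarBasis b')
    (h : ∀ i, (b' i).I = (b i).I) : Nonempty (M ≅ N) := by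
  obtain ⟨f, hf⟩ := hb.exists_hom b' h
  obtain ⟨g, hg⟩ := hb'.exists_hom b fun i => (h i).symm
  refine ⟨⟨f, g, ?_, ?_⟩⟩
  · ext t : 2
    refine ModuleCat.hom_ext (hb.ext fun i _ => ?_)
    exact (congrArg (g.app t).hom (hf i t)).trans (hg i t)
  · ext t : 2
    refine ModuleCat.hom_ext (hb'.ext fun i _ => ?_)
    exact (congrArg (f.app t).hom (hg i t)).trans (hf i t)

theorem IsBarBasis.reindex (hb : IsBarBasis b) {κ : Type*} (e : κ ≃ ι) :
    IsBarBasis fun k => b (e k) := by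
  intro t
  have himg : {i | t ∈ (b i).I.carrier} = e '' {k | t ∈ (b (e k)).I.carrier} := by
    ext i
    constructor
    · intro hi
      exact ⟨e.symm i, by simpa using hi, by simp⟩
    · rintro ⟨k, hk, rfl⟩
      exact hk
  have h := hb t
  rw [himg, Set.image_image] at h
  exact ⟨h.1.comp_of_image e.injective.injOn, h.2⟩

/-- The image of a bar under a morphism. -/
def Bar.map_hom (b : Bar M) (f : M ⟶ N) : Bar N where
  I := b.I
  v t := (f.app t).hom (b.v t)
  zero t ht := by rw [b.zero t ht, map_zero]
  map h hs := by rw [← app_trans, b.map h hs]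

theorem IsBarBasis.map_iso (hb : IsBarBasis b) (e : M ≅ N) :
    IsBarBasis fun i => (b i).map_hom e.hom := by
  intro t
  let E : M.obj t ≃ₗ[K] N.obj t := (e.app t).toLinearEquiv
  constructor
  · exact (hb t).1.map' E.toLinearMap E.ker
  · have := congrArg (Submodule.map E.toLinearMap) (top_le_iff.1 (hb t).2)
    rw [Submodule.map_span, Submodule.map_top, LinearEquiv.range, Set.image_image] at this
    exact this.ge

end BarBasis

/-! ### Barcodes and bases of bars -/

section Barcode

variable {K : Type u} [Field K]

variable (K) in
open scoped Classical in
/-- The generator of the interval module on `I`. -/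
noncomputable def intervalOne (I : RInterval) (t : ℝ) : intervalFiber K I t :=
  if h : t ∈ I.carrier then ⟨1, by rw [intervalFiber, if_pos h]; trivial⟩ else 0

theorem coe_intervalOne {I : RInterval} {t : ℝ} (h : t ∈ I.carrier) :
    (intervalOne K I t : K) = 1 := by
  rw [intervalOne, dif_pos h]

/-- The generator of a summand of a direct sum of interval modules. -/
noncomputable def directSumBar {ι : Type} (I : ι → RInterval) (i : ι) :
    Bar (directSum fun i => intervalModule K (I i)) where
  I := I i
  v t := by
    classical exact DirectSum.lof K ι (fun i => intervalFiber K (I i) t) i (intervalOne K (I i) t)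
  zero t ht := by
    rw [intervalOne, dif_neg ht]
    exact map_zero _
  map {s t} h hs := by
    classical
    refine (DirectSum.lmap_lof (R := K) (fun i => intervalMap K (I i) s t) i _).trans ?_
    congr 1
    by_cases ht : t ∈ (I i).carrier
    · apply Subtype.ext
      rw [coe_intervalMap_of_mem hs ht, coe_intervalOne hs, coe_intervalOne ht]
    · exact (coe_eq_zero_of_notMem ht _).trans (coe_eq_zero_of_notMem ht _).symm

theorem isBarBasis_directSumBar {ι : Type} (I : ι → RInterval) :
    IsBarBasis (directSumBar (K := K) I) := by
  classical
  intro t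
  let v : ι → ⨁ i, intervalFiber K (I i) t := fun i =>
    DirectSum.lof K ι (fun i => intervalFiber K (I i) t) i (intervalOne K (I i) t)
  change LinearIndepOn K v {i | t ∈ (I i).carrier} ∧
    ⊤ ≤ Submodule.span K (v '' {i | t ∈ (I i).carrier})
  constructor
  · let ψ : (⨁ i, intervalFiber K (I i) t) →ₗ[K] ι → K :=
      LinearMap.pi fun i => (intervalFiber K (I i) t).subtype ∘ₗ DirectSum.component K ι _ i
    have hψ : ∀ i : {i | t ∈ (I i).carrier}, ψ (v i) = Pi.single i.1 1 := by
      intro i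
      ext j
      change ((DirectSum.component K ι (fun i => intervalFiber K (I i) t) j (v i) :
        intervalFiber K (I j) t) : K) = _
      by_cases hij : j = i.1
      · obtain ⟨i, hi⟩ := i
        subst hij
        simp only [v]
        rw [DirectSum.component.lof_self, coe_intervalOne hi, Pi.single_eq_same]
      · simp only [v]
        rw [DirectSum.component.of, dif_neg (Ne.symm hij), Pi.single_eq_of_ne hij]
        rfl
    refine LinearIndependent.of_comp ψ ?_
    have h := (Pi.linearIndependent_single_one ι K).comp
      (Subtype.val : {i | t ∈ (I i).carrier} → ι) Subtype.val_injective
    convert h using 1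
    exact funext hψ
  · intro x _
    induction x using DirectSum.induction_on with
    | zero => exact Submodule.zero_mem _
    | add x y hx hy => exact Submodule.add_mem _ (hx trivial) (hy trivial)
    | of i x =>
      by_cases hi : t ∈ (I i).carrier
      · have hx : x = (x : K) • intervalOne K (I i) t := by
          apply Subtype.ext
          rw [Submodule.coe_smul, coe_intervalOne hi, smul_eq_mul, mul_one]
        rw [hx]
        change DirectSum.lof K ι (fun i => intervalFiber K (I i) t) i _ ∈ _
        rw [map_smul]
        exact Submodule.smul_mem _ _ (Submodule.subset_span ⟨i, hi, rfl⟩)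
      · rw [coe_eq_zero_of_notMem hi x, map_zero]
        exact Submodule.zero_mem _

/-- A barcode of `M` is the same thing as a basis of bars with these intervals. -/
theorem isBarcode_iff {M : PersistenceModule K} {C : Barcode} :
    IsBarcode M C ↔ ∃ b : C.Elements → Bar M, IsBarBasis b ∧ ∀ x, (b x).I = x.1 := by
  constructor
  · rintro ⟨e⟩
    exact ⟨_, (isBarBasis_directSumBar _).map_iso e.symm, fun _ => rfl⟩
  · rintro ⟨b, hb, hI⟩
    exact hb.nonempty_iso (isBarBasis_directSumBar _) fun x => (hI x).symm

theorem exists_isBarcode (M : PersistenceModule K) (hM : IsPFD M) : ∃ C, IsBarcode M C := by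
  obtain ⟨S, hS⟩ := exists_isBarBasis M hM
  -- Bars with the same interval are all alive at a common time, where the space is
  -- finite-dimensional; so multiplicities are finite.
  have hfin : ∀ I : RInterval, Finite {x : S // x.1.I = I} := by
    intro I
    obtain ⟨t, ht⟩ := span_nonempty I.lower_lt_upper
    refine ((hS.finite hM t).subset fun x (hx : x.1.I = I) => ?_).to_subtype
    change t ∈ x.1.I.carrier
    rw [hx]
    exact ht
  let C : Barcode := fun I => Nat.card {x : S // x.1.I = I}
  let e : C.Elements ≃ S := (Equiv.sigmaCongrRight fun I =>
    (Finite.equivFin {x : S // x.1.I = I}).symm).trans (Equiv.sigmaFiberEquiv fun x : S => x.1.I)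
  refine ⟨C, isBarcode_iff.2 ⟨fun k => (e k).1, hS.reindex e, fun x => ?_⟩⟩
  exact ((Finite.equivFin {y : S // y.1.I = x.1}).symm x.2).2

end Barcode

/-! ### Translation of endpoints -/

theorem Endpoint.minus_shift (s t : ℝ) :
    (Endpoint.minus s).shift t = Endpoint.minus (s + t) := rfl

theorem Endpoint.plus_shift (s t : ℝ) : (Endpoint.plus s).shift t = Endpoint.plus (s + t) := rfl

theorem Endpoint.bot_shift (t : ℝ) : (⊥ : Endpoint).shift t = ⊥ := rfl

theorem Endpoint.top_shift (t : ℝ) : (⊤ : Endpoint).shift t = ⊤ := rfl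

theorem Endpoint.shift_shift (e : Endpoint) (s t : ℝ) : (e.shift s).shift t = e.shift (s + t) := by
  rcases e.eq_cases with rfl | ⟨r, rfl⟩ | ⟨r, rfl⟩ | rfl
  · rfl
  · simp only [Endpoint.minus_shift, add_assoc]
  · simp only [Endpoint.plus_shift, add_assoc]
  · rfl

theorem Endpoint.shift_zero (e : Endpoint) : e.shift 0 = e := by
  rcases e.eq_cases with rfl | ⟨r, rfl⟩ | ⟨r, rfl⟩ | rfl
  · rfl
  · rw [Endpoint.minus_shift, add_zero]
  · rw [Endpoint.plus_shift, add_zero]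
  · rfl

theorem Endpoint.shift_mono (t : ℝ) : Monotone fun e : Endpoint => e.shift t := by
  refine Monotone.withBot_map (Monotone.withTop_map fun p q h => ?_)
  rw [Prod.Lex.le_iff] at h
  rw [Prod.Lex.toLex_le_toLex]
  simpa using h

theorem Endpoint.shift_le_shift_iff {e f : Endpoint} (t : ℝ) :
    e.shift t ≤ f.shift t ↔ e ≤ f := by
  refine ⟨fun h => ?_, fun h => Endpoint.shift_mono t h⟩
  have := Endpoint.shift_mono (-t) h
  simpa only [Endpoint.shift_shift, add_neg_cancel, Endpoint.shift_zero] using this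

theorem Endpoint.shift_neg_le_iff {e f : Endpoint} (t : ℝ) :
    e.shift (-t) ≤ f ↔ e ≤ f.shift t := by
  rw [← Endpoint.shift_le_shift_iff t, Endpoint.shift_shift, neg_add_cancel, Endpoint.shift_zero]

theorem carrier_subset_span_iff {I : RInterval} {b d : Endpoint} :
    I.carrier ⊆ span b d ↔ b ≤ I.lower ∧ I.upper ≤ d := by
  refine ⟨fun h => ?_, fun h t ht => ⟨h.1.trans ht.1, ht.2.trans h.2⟩⟩
  obtain ⟨x, hx⟩ := span_nonempty I.lower_lt_upper
  constructor
  · by_contra hlt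
    obtain ⟨t, ht1, ht2⟩ := span_nonempty (not_le.1 hlt)
    have htI : t ∈ I.carrier :=
      ⟨ht1, ht2.trans ((h hx).1.trans ((Endpoint.minus_lt_plus x).le.trans hx.2))⟩
    exact absurd (ht2.trans (h htI).1) (not_le.2 (Endpoint.minus_lt_plus t))
  · by_contra hlt
    obtain ⟨t, ht1, ht2⟩ := span_nonempty (not_le.1 hlt)
    have htI : t ∈ I.carrier :=
      ⟨hx.1.trans ((Endpoint.minus_lt_plus x).le.trans ((h hx).2.trans ht1)), ht2⟩
    exact absurd ((h htI).2.trans ht1) (not_le.2 (Endpoint.minus_lt_plus t))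

/-- Both endpoints of `J - δ` are at most the corresponding endpoints of `I`. If there is a nonzero
morphism from `C(I)` to `C(J)(δ)` then this holds. -/
def RInterval.LeShift (δ : ℝ) (I J : RInterval) : Prop :=
  J.lower ≤ I.lower.shift δ ∧ J.upper ≤ I.upper.shift δ

theorem RInterval.LeShift.lower_le {δ : ℝ} {I J : RInterval} (h : I.LeShift δ J) {t : ℝ}
    (ht : I.lower ≤ Endpoint.minus t) : J.lower ≤ Endpoint.minus (t + δ) :=
  h.1.trans (Endpoint.shift_mono δ ht)

theorem RInterval.LeShift.le_upper {δ : ℝ} {I J : RInterval} (h : I.LeShift δ J) {t : ℝ}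
    (ht : Endpoint.plus (t + δ) ≤ J.upper) : Endpoint.plus t ≤ I.upper :=
  (Endpoint.shift_le_shift_iff δ).1 (ht.trans h.2)

theorem IsDeltaMatching.leShift_left {δ : ℝ≥0} {C D : Barcode} {σ : C.Elements ≃. D.Elements}
    (h : IsDeltaMatching δ σ) {I : C.Elements} {J : D.Elements} (hIJ : J ∈ σ I) :
    I.1.LeShift δ J.1 :=
  ⟨(Endpoint.shift_neg_le_iff _).1 (carrier_subset_span_iff.1 (h.subset_left I J hIJ)).1,
    (carrier_subset_span_iff.1 (h.subset_right I J hIJ)).2⟩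

theorem IsDeltaMatching.leShift_right {δ : ℝ≥0} {C D : Barcode} {σ : C.Elements ≃. D.Elements}
    (h : IsDeltaMatching δ σ) {I : C.Elements} {J : D.Elements} (hIJ : J ∈ σ I) :
    J.1.LeShift δ I.1 :=
  ⟨(Endpoint.shift_neg_le_iff _).1 (carrier_subset_span_iff.1 (h.subset_right I J hIJ)).1,
    (carrier_subset_span_iff.1 (h.subset_left I J hIJ)).2⟩

theorem subset_span_of_leShift {δ : ℝ} {I J : RInterval} (h : I.LeShift δ J)
    (h' : J.LeShift δ I) : I.carrier ⊆ span (J.lower.shift (-δ)) (J.upper.shift δ) :=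
  carrier_subset_span_iff.2 ⟨(Endpoint.shift_neg_le_iff _).2 h.1, h'.2⟩

/-! ### Interleavings from matchings -/

section Converse

variable {K : Type u} [Field K] {M N : PersistenceModule K}

/-- The components of a morphism `M → N(δ)`, as linear maps `M_t → N_{t + δ}`. -/
def appShift {δ : ℝ} (f : M ⟶ (shift δ).obj N) (t : ℝ) : M.obj t →ₗ[K] N.obj (t + δ) :=
  (f.app t).hom

theorem appShift_trans {δ : ℝ} (f : M ⟶ (shift δ).obj N) {s t : ℝ} (h : s ≤ t) (x : M.obj s) :
    appShift f t (trans M h x) = trans N (by linarith : s + δ ≤ t + δ) (appShift f s x) :=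
  app_trans f h x

open scoped Classical in
/-- The morphism `C(I) → N(δ)` induced by a bar of `N`. -/
noncomputable def Bar.shiftRestrict (c : Bar N) (δ : ℝ) (I : RInterval) (h : I.LeShift δ c.I) :
    Bar ((shift δ).obj N) where
  I := I
  v t := if t ∈ I.carrier then c.v (t + δ) else 0
  zero t ht := if_neg ht
  map {s t} hst hs := by
    have hadd : s + δ ≤ t + δ := by linarith
    -- The lower inequality of `LeShift` says that the target bar is already born at `s + δ`, the
    -- upper one that the source bar has not yet died at `t`.
    have hsc : t + δ ∈ c.I.carrier → s + δ ∈ c.I.carrier ∧ t ∈ I.carrier := fun ht =>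
      ⟨⟨h.lower_le hs.1, ((Endpoint.plus_le_plus_iff _ _).2 hadd).trans ht.2⟩,
        hs.1.trans ((Endpoint.minus_le_minus_iff _ _).2 hst), h.le_upper ht.2⟩
    have key : trans N hadd (if s ∈ I.carrier then c.v (s + δ) else 0) =
        if t ∈ I.carrier then c.v (t + δ) else 0 := by
      rw [if_pos hs]
      by_cases hs' : s + δ ∈ c.I.carrier
      · rw [c.map hadd hs']
        split_ifs with ht
        · rfl
        · exact c.zero _ fun h' => ht (hsc h').2
      · rw [c.zero _ hs', map_zero, c.zero _ fun h' => hs' (hsc h').1, ite_self]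
    exact key

theorem exists_hom_of_partial {ι κ : Type*} {b : ι → Bar M} (hb : IsBarBasis b) (b' : κ → Bar N)
    (δ : ℝ) (m : ι → Option κ) (hm : ∀ i, ∀ j ∈ m i, (b i).I.LeShift δ (b' j).I) :
    ∃ f : M ⟶ (shift δ).obj N, ∀ i t, t ∈ (b i).I.carrier →
      (∀ j ∈ m i, appShift f t ((b i).v t) = (b' j).v (t + δ)) ∧
      (m i = none → appShift f t ((b i).v t) = 0) := by
  have hw : ∀ i, ∃ w : Bar ((shift δ).obj N), w.I = (b i).I ∧ ∀ t, t ∈ (b i).I.carrier →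
      (∀ j ∈ m i, w.v t = (b' j).v (t + δ)) ∧ (m i = none → w.v t = 0) := by
    intro i
    cases hmi : m i with
    | none =>
      exact ⟨⟨(b i).I, fun _ => 0, fun _ _ => rfl, fun _ _ => map_zero _⟩, rfl,
        fun t _ => ⟨fun j hj => (Option.not_mem_none j hj).elim, fun _ => rfl⟩⟩
    | some j =>
      refine ⟨(b' j).shiftRestrict δ (b i).I (hm i j hmi), rfl, fun t ht => ⟨?_, fun h => ?_⟩⟩
      · intro j' hj'
        obtain rfl := Option.mem_some_iff.1 hj'
        exact if_pos ht
      · cases h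
  choose w hwI hwv using hw
  obtain ⟨f, hf⟩ := hb.exists_hom w hwI
  refine ⟨f, fun i t ht => ?_⟩
  have h : appShift f t ((b i).v t) = (w i).v t := hf i t
  exact ⟨fun j hj => h.trans ((hwv i t ht).1 j hj), fun hi => h.trans ((hwv i t ht).2 hi)⟩

/-- It suffices to check the bars. An unmatched one has length at most `2δ`, so it is dead after
`2δ`. A matched one that is still alive after `2δ` has its partner alive halfway, so the composite
carries it to itself. -/
theorem comp_eq_trans_of_partial {ι κ : Type*} {b : ι → Bar M} (hb : IsBarBasis b)
    {b' : κ → Bar N} {δ : ℝ} (hδ : 0 ≤ δ) {m : ι → Option κ} {m' : κ → Option ι}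
    (hm : ∀ i, ∀ j ∈ m i, (b i).I.LeShift δ (b' j).I)
    (hm' : ∀ j, ∀ i ∈ m' j, (b' j).I.LeShift δ (b i).I)
    (hmm' : ∀ i, ∀ j ∈ m i, i ∈ m' j)
    (hdom : ∀ i, m i = none → (b i).I.upper ≤ (b i).I.lower.shift (2 * δ))
    {f : M ⟶ (shift δ).obj N} {g : N ⟶ (shift δ).obj M}
    (hf : ∀ i t, t ∈ (b i).I.carrier →
      (∀ j ∈ m i, appShift f t ((b i).v t) = (b' j).v (t + δ)) ∧
      (m i = none → appShift f t ((b i).v t) = 0))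
    (hg : ∀ i t, t ∈ (b' i).I.carrier → ∀ j ∈ m' i, appShift g t ((b' i).v t) = (b j).v (t + δ))
    (t : ℝ) : (f ≫ (shift δ).map g).app t =
      M.map (homOfLE (by linarith : t ≤ t + δ + δ)) := by
  refine ModuleCat.hom_ext (hb.ext fun i hi => ?_)
  change appShift g (t + δ) (appShift f t ((b i).v t)) =
    trans M (by linarith : t ≤ t + δ + δ) ((b i).v t)
  rw [(b i).map _ hi]
  cases hmi : m i with
  | none =>
    rw [(hf i t hi).2 hmi, map_zero, (b i).zero]
    intro hi'
    have h1 := (hi'.2.trans (hdom i hmi)).trans (Endpoint.shift_mono (2 * δ) hi.1)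
    change Endpoint.plus _ ≤ (Endpoint.minus t).shift (2 * δ) at h1
    rw [Endpoint.minus_shift, Endpoint.plus_le_minus_iff] at h1
    linarith
  | some j =>
    rw [(hf i t hi).1 j hmi]
    by_cases hj : t + δ ∈ (b' j).I.carrier
    · exact hg j _ hj i (hmm' i j hmi)
    · rw [(b' j).zero _ hj, map_zero, (b i).zero]
      intro hi'
      exact hj ⟨(hm i j hmi).lower_le hi.1, (hm' j i (hmm' i j hmi)).le_upper hi'.2⟩

theorem interleaved_of_deltaMatched {C D : Barcode} (hC : IsBarcode M C) (hD : IsBarcode N D)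
    {δ : ℝ≥0} (h : DeltaMatched δ C D) : Interleaved δ M N := by
  obtain ⟨b, hb, hbI⟩ := isBarcode_iff.1 hC
  obtain ⟨b', hb', hbI'⟩ := isBarcode_iff.1 hD
  obtain ⟨σ, hσ⟩ := h
  have hm : ∀ i, ∀ j ∈ σ i, (b i).I.LeShift δ (b' j).I := fun i j hij => by
    rw [hbI, hbI']
    exact hσ.leShift_left hij
  have hm' : ∀ j, ∀ i ∈ σ.symm j, (b' j).I.LeShift δ (b i).I := fun j i hij => by
    rw [hbI, hbI']
    exact hσ.leShift_right ((σ.mem_iff_mem).1 hij)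
  obtain ⟨f, hf⟩ := exists_hom_of_partial hb b' δ σ hm
  obtain ⟨g, hg⟩ := exists_hom_of_partial hb' b δ σ.symm hm'
  refine ⟨f, g, comp_eq_trans_of_partial hb δ.coe_nonneg hm hm' (fun i j h => σ.mem_iff_mem.2 h)
    ?_ hf fun j t ht => (hg j t ht).1, comp_eq_trans_of_partial hb' δ.coe_nonneg hm' hm
    (fun i j h => σ.mem_iff_mem.1 h) ?_ hg fun j t ht => (hf j t ht).1⟩
  · intro i hi
    rw [hbI]
    by_contra hlt
    obtain ⟨j, hj⟩ := hσ.dom i (not_le.1 hlt)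
    rw [hi] at hj
    cases hj
  · intro j hj
    rw [hbI']
    by_contra hlt
    obtain ⟨i, hi⟩ := hσ.im j (not_le.1 hlt)
    rw [← σ.mem_iff_mem, hj] at hi
    cases hi

end Converse

/-! ### Combinatorics of matchings -/

/-- Two matrices whose product is triangular with unit diagonal, up to reordering by `α`. -/
theorem card_le_card_of_triangular {K ι κ G : Type*} [Field K] [Fintype ι] [Fintype κ]
    [DecidableEq ι] [LinearOrder G] (w : ι → κ → K) (z : κ → ι → K) (α : ι → G)
    (h : ∀ i j, α i ≤ α j → ∑ k, w i k * z k j = if i = j then 1 else 0) :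
    Fintype.card ι ≤ Fintype.card κ := by
  let L : (ι → K) →ₗ[K] κ → K := Matrix.mulVecLin (Matrix.of fun k i => w i k)
  have hL : Function.Injective L := by
    rw [← LinearMap.ker_eq_bot, LinearMap.ker_eq_bot']
    intro x hx
    by_contra hne
    obtain ⟨i₀, hi₀⟩ := Function.ne_iff.1 hne
    classical
    -- For a nonzero kernel vector `x`, take `j` of largest `α` in its support: every other index of
    -- the support falls under the triangularity hypothesis, so pairing with column `j` of the
    -- product gives exactly `x j`.
    obtain ⟨j, hj, hmax⟩ := Finset.exists_max_image (Finset.univ.filter fun i => x i ≠ 0) α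
      ⟨i₀, Finset.mem_filter.2 ⟨Finset.mem_univ _, hi₀⟩⟩
    have hk : ∀ k, ∑ i, w i k * x i = 0 := fun k => congrFun hx k
    have h0 : ∑ i, x i * ∑ k, w i k * z k j = 0 := by
      simp only [Finset.mul_sum]
      rw [Finset.sum_comm]
      refine Finset.sum_eq_zero fun k _ => ?_
      rw [← zero_mul (z k j), ← hk k, Finset.sum_mul]
      exact Finset.sum_congr rfl fun i _ => by ring
    rw [Finset.sum_eq_single j] at h0
    · rw [h j j le_rfl, if_pos rfl, mul_one] at h0
      exact (Finset.mem_filter.1 hj).2 h0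
    · intro i _ hij
      by_cases hi : x i = 0
      · rw [hi, zero_mul]
      · rw [h i j (hmax i (Finset.mem_filter.2 ⟨Finset.mem_univ _, hi⟩)), if_neg hij, mul_zero]
    · exact fun h => absurd (Finset.mem_univ _) h
  simpa using LinearMap.finrank_le_finrank_of_injective hL

/-- The elements matched by `f` when a matching along `f` and a matching along `g` are merged. -/
inductive MergeSet {X Y : Type*} (A : Set X) (B : Set Y) (f : A → Y) (g : B → X) : X → Prop
  | base (x : X) (hx : x ∈ A) (h : ∀ y, g y ≠ x) : MergeSet A B f g x
  | step (x : A) (y : B) (hx : MergeSet A B f g x.1) (h : f x = y.1) : MergeSet A B f g (g y)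

/-- Given a matching covering `A` and a matching covering `B`, there is a matching covering both
`A` and `B` (the Mendelsohn–Dulmage theorem, for arbitrary bipartite graphs). -/
theorem exists_pequiv_covering {X Y : Type*} (R : X → Y → Prop) (A : Set X) (B : Set Y)
    (f : A → Y) (hf : Function.Injective f) (hfR : ∀ x, R x.1 (f x))
    (g : B → X) (hg : Function.Injective g) (hgR : ∀ y, R (g y) y.1) :
    ∃ σ : X ≃. Y, (∀ x ∈ A, ∃ y, y ∈ σ x) ∧ (∀ y ∈ B, ∃ x, y ∈ σ x) ∧ ∀ x y, y ∈ σ x → R x y := by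
  classical
  -- `S` consists of the ends in `X` of the alternating paths starting at points of `A` not hit by
  -- `g`. The edges of `f` are used on `S` and those of `g` off it, as in the Schröder–Bernstein
  -- argument; closure of `S` under `g ∘ f` prevents clashes.
  let S := MergeSet A B f g
  let E : X → Y → Prop := fun x y =>
    (S x ∧ ∃ h : x ∈ A, f ⟨x, h⟩ = y) ∨ (¬ S x ∧ ∃ h : y ∈ B, g ⟨y, h⟩ = x)
  have hE1 : ∀ x y y', E x y → E x y' → y = y' := by
    rintro x y y' (⟨hS, h, rfl⟩ | ⟨hS, h, e⟩) (⟨hS', h', rfl⟩ | ⟨hS', h', e'⟩)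
    · rfl
    · exact absurd hS hS'
    · exact absurd hS' hS
    · exact congrArg Subtype.val (hg (e.trans e'.symm))
  have hE2 : ∀ x x' y, E x y → E x' y → x = x' := by
    rintro x x' y (⟨hS, h, e⟩ | ⟨hS, h, rfl⟩) (⟨hS', h', e'⟩ | ⟨hS', h', rfl⟩)
    · exact congrArg Subtype.val (hf (e.trans e'.symm))
    · exact absurd (MergeSet.step ⟨x, h⟩ ⟨y, h'⟩ hS e) hS'
    · exact absurd (MergeSet.step ⟨x', h'⟩ ⟨y, h⟩ hS' e') hS
    · rfl
  let toFun : X → Option Y := fun x => if h : ∃ y, E x y then some h.choose else none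
  let inv : Y → Option X := fun y => if h : ∃ x, E x y then some h.choose else none
  have hmem : ∀ x y, y ∈ toFun x ↔ E x y := by
    intro x y
    by_cases h : ∃ y, E x y
    · simp only [toFun, dif_pos h, Option.mem_some_iff]
      exact ⟨fun e => e ▸ h.choose_spec, fun e => hE1 x _ _ h.choose_spec e⟩
    · simp only [toFun, dif_neg h]
      exact ⟨fun e => (Option.not_mem_none _ e).elim, fun e => absurd ⟨y, e⟩ h⟩
  have hinv : ∀ x y, x ∈ inv y ↔ E x y := by
    intro x y
    by_cases h : ∃ x, E x y
    · simp only [inv, dif_pos h, Option.mem_some_iff]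
      exact ⟨fun e => e ▸ h.choose_spec, fun e => hE2 _ _ y h.choose_spec e⟩
    · simp only [inv, dif_neg h]
      exact ⟨fun e => (Option.not_mem_none _ e).elim, fun e => absurd ⟨x, e⟩ h⟩
  refine ⟨⟨toFun, inv, fun x y => (hinv x y).trans (hmem x y).symm⟩, ?_, ?_, ?_⟩
  · intro x hx
    by_cases hS : S x
    · exact ⟨_, (hmem _ _).2 (Or.inl ⟨hS, hx, rfl⟩)⟩
    · obtain ⟨y, hy⟩ : ∃ y, g y = x := by
        by_contra! h
        exact hS (MergeSet.base x hx h)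
      exact ⟨y.1, (hmem _ _).2 (Or.inr ⟨hS, y.2, hy⟩)⟩
  · intro y hy
    by_cases hS : S (g ⟨y, hy⟩)
    -- A value of `g` can enter `S` only by `step`, so `y` is the `f`-image of a point of `S`.
    · generalize hx : g ⟨y, hy⟩ = x at hS
      cases hS with
      | base _ hA h => exact absurd hx (h _)
      | step x' y' hx' h =>
        obtain rfl := hg hx
        exact ⟨x'.1, (hmem _ _).2 (Or.inl ⟨hx', x'.2, h⟩)⟩
    · exact ⟨_, (hmem _ _).2 (Or.inr ⟨hS, hy, rfl⟩)⟩
  · intro x y hxy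
    rcases (hmem x y).1 hxy with ⟨-, h, rfl⟩ | ⟨-, h, rfl⟩
    · exact hfR ⟨x, h⟩
    · exact hgR ⟨y, h⟩

/-! ### An ordered group containing the endpoints -/

/-- A linearly ordered group into which the endpoints are embedded. -/
abbrev EndpointGroup : Type := ℤ ×ₗ (ℝ ×ₗ ℤ)

/-- The element of `EndpointGroup` corresponding to a real translation. -/
def EndpointGroup.ofReal (t : ℝ) : EndpointGroup := toLex (0, toLex (t, 0))

/-- The embedding of the endpoints into an ordered group. -/
noncomputable def Endpoint.toGroup : Endpoint → EndpointGroup :=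
  WithBot.recBotCoe (toLex (-1, toLex (0, 0))) (WithTop.recTopCoe (toLex (1, toLex (0, 0)))
    fun p => toLex (0, toLex ((ofLex p).1, if (ofLex p).2 then 1 else 0)))

theorem Endpoint.toGroup_bot : (⊥ : Endpoint).toGroup = toLex (-1, toLex (0, 0)) := rfl

theorem Endpoint.toGroup_top : (⊤ : Endpoint).toGroup = toLex (1, toLex (0, 0)) := rfl

theorem Endpoint.toGroup_minus (t : ℝ) :
    (Endpoint.minus t).toGroup = toLex (0, toLex (t, 0)) := rfl

theorem Endpoint.toGroup_plus (t : ℝ) :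
    (Endpoint.plus t).toGroup = toLex (0, toLex (t, 1)) := rfl

theorem EndpointGroup.add_ofReal (n : ℤ) (t : ℝ) (i : ℤ) (s : ℝ) :
    (toLex (n, toLex (t, i)) : EndpointGroup) + EndpointGroup.ofReal s =
      toLex (n, toLex (t + s, i)) := by
  simp only [EndpointGroup.ofReal, ← toLex_add, Prod.mk_add_mk, add_zero]

theorem EndpointGroup.le_iff (m n : ℤ) (s t : ℝ) (i j : ℤ) :
    (toLex (m, toLex (s, i)) : EndpointGroup) ≤ toLex (n, toLex (t, j)) ↔
      m < n ∨ m = n ∧ (s < t ∨ s = t ∧ i ≤ j) := by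
  rw [Prod.Lex.toLex_le_toLex, Prod.Lex.toLex_le_toLex]

theorem Endpoint.toGroup_mono : Monotone Endpoint.toGroup := by
  intro e f h
  rcases e.eq_cases with rfl | ⟨r, rfl⟩ | ⟨r, rfl⟩ | rfl <;>
    rcases f.eq_cases with rfl | ⟨r', rfl⟩ | ⟨r', rfl⟩ | rfl <;>
    try simp only [Endpoint.minus_le_minus_iff, Endpoint.minus_le_plus_iff,
      Endpoint.plus_le_minus_iff, Endpoint.plus_le_plus_iff, le_bot_iff, top_le_iff] at h
  all_goals
    try simp [Endpoint.toGroup_bot, Endpoint.toGroup_top, Endpoint.toGroup_minus,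
      Endpoint.toGroup_plus, EndpointGroup.le_iff, ← le_iff_lt_or_eq, h]

theorem Endpoint.toGroup_strictMono : StrictMono Endpoint.toGroup := by
  refine Endpoint.toGroup_mono.strictMono_of_injective fun e f h => ?_
  rcases e.eq_cases with rfl | ⟨r, rfl⟩ | ⟨r, rfl⟩ | rfl <;>
    rcases f.eq_cases with rfl | ⟨r', rfl⟩ | ⟨r', rfl⟩ | rfl <;>
    simp_all [Endpoint.toGroup_bot, Endpoint.toGroup_top, Endpoint.toGroup_minus,
      Endpoint.toGroup_plus]

theorem EndpointGroup.ofReal_nonneg {s : ℝ} (hs : 0 ≤ s) : 0 ≤ EndpointGroup.ofReal s :=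
  (EndpointGroup.le_iff 0 0 0 s 0 0).2 (Or.inr ⟨rfl, by simpa [← le_iff_lt_or_eq] using hs⟩)

/-- Infinite endpoints are fixed by `shift` but are moved by `ofReal s` in the group; `0 ≤ s` makes
the inequality survive. -/
theorem Endpoint.toGroup_le {e f : Endpoint} {s : ℝ} (hs : 0 ≤ s) (h : e ≤ f.shift s) :
    e.toGroup ≤ f.toGroup + EndpointGroup.ofReal s := by
  have h0 := EndpointGroup.ofReal_nonneg hs
  have h' := Endpoint.toGroup_mono h
  rcases f.eq_cases with rfl | ⟨r, rfl⟩ | ⟨r, rfl⟩ | rfl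
  · exact h'.trans (le_add_of_nonneg_right h0)
  · rwa [Endpoint.toGroup_minus, EndpointGroup.add_ofReal]
  · rwa [Endpoint.toGroup_plus, EndpointGroup.add_ofReal]
  · exact h'.trans (le_add_of_nonneg_right h0)

theorem Endpoint.toGroup_lt {e f : Endpoint} {s : ℝ} (h : e.shift s < f) :
    e.toGroup + EndpointGroup.ofReal s < f.toGroup := by
  rcases e.eq_cases with rfl | ⟨r, rfl⟩ | ⟨r, rfl⟩ | rfl
  · rw [Endpoint.bot_shift] at h
    rw [Endpoint.toGroup_bot, EndpointGroup.add_ofReal, ← not_le]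
    rcases f.eq_cases with rfl | ⟨r, rfl⟩ | ⟨r, rfl⟩ | rfl
    · exact absurd h (lt_irrefl _)
    · simp [Endpoint.toGroup_minus, EndpointGroup.le_iff]
    · simp [Endpoint.toGroup_plus, EndpointGroup.le_iff]
    · simp [Endpoint.toGroup_top, EndpointGroup.le_iff]
  · rw [Endpoint.toGroup_minus, EndpointGroup.add_ofReal]
    exact Endpoint.toGroup_strictMono h
  · rw [Endpoint.toGroup_plus, EndpointGroup.add_ofReal]
    exact Endpoint.toGroup_strictMono h
  · rw [Endpoint.top_shift] at h
    exact absurd h not_top_lt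

/-- Twice the centre of an interval, in the ordered group of endpoints. -/
noncomputable def RInterval.centre (I : RInterval) : EndpointGroup :=
  I.lower.toGroup + I.upper.toGroup

/-- An interval `J` through which there is a morphism `C(I) → C(J)(δ) → C(I')(2δ)` can be matched
with `I` or with `I'`, if the centre of `I` is not to the right of that of `I'`. -/
theorem RInterval.LeShift.symm_or {δ : ℝ} (hδ : 0 ≤ δ) {I J I' : RInterval} (h : I.LeShift δ J)
    (h' : J.LeShift δ I') (hc : I.centre ≤ I'.centre) : J.LeShift δ I ∨ I'.LeShift δ J := by
  have h0 := EndpointGroup.ofReal_nonneg hδ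
  have h1 := Endpoint.toGroup_le hδ h.1
  have h2 := Endpoint.toGroup_le hδ h.2
  have h1' := Endpoint.toGroup_le hδ h'.1
  have h2' := Endpoint.toGroup_le hδ h'.2
  unfold RInterval.centre at hc
  by_contra! hne
  have key : ∀ {I J : RInterval}, ¬ J.LeShift δ I →
      J.lower.toGroup + EndpointGroup.ofReal δ < I.lower.toGroup ∨
        J.upper.toGroup + EndpointGroup.ofReal δ < I.upper.toGroup := by
    intro I J hn
    by_cases hl : I.lower ≤ J.lower.shift δ
    · exact Or.inr (Endpoint.toGroup_lt (not_le.1 fun hu => hn ⟨hl, hu⟩))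
    · exact Or.inl (Endpoint.toGroup_lt (not_le.1 hl))
  -- Each of the two failures breaks an inequality at one endpoint. In all four combinations the sum
  -- of the endpoints of `I'` is strictly below that of `I`.
  rcases key hne.1 with h3 | h3 <;> rcases key hne.2 with h4 | h4 <;> clear key hne h h' <;> grind

theorem RInterval.LeShift.exists_mem {δ : ℝ} (hδ : 0 ≤ δ) {I J I' : RInterval}
    (h : I.LeShift δ J) (h' : J.LeShift δ I') (hI : I.lower.shift (2 * δ) < I.upper)
    (hI' : I'.lower.shift (2 * δ) < I'.upper) (hc : I.centre ≤ I'.centre) :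
    ∃ t, t ∈ I.carrier ∧ t + δ + δ ∈ I'.carrier := by
  have hlower : I'.lower ≤ I.lower.shift (2 * δ) := by
    rw [two_mul, ← Endpoint.shift_shift]
    exact h'.1.trans (Endpoint.shift_mono δ h.1)
  have hupper : I'.upper ≤ I.upper.shift (2 * δ) := by
    rw [two_mul, ← Endpoint.shift_shift]
    exact h'.2.trans (Endpoint.shift_mono δ h.2)
  -- Otherwise both endpoints of `I'` would lie strictly below those of `I`, because both intervals
  -- are longer than `2δ`.
  have hlt : I.lower.shift (2 * δ) < I'.upper := by
    by_contra! hle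
    have h1 := Endpoint.toGroup_lt hI
    have h2 := Endpoint.toGroup_lt hI'
    have h3 := Endpoint.toGroup_le (by linarith) hle
    unfold RInterval.centre at hc
    clear h h' hle hlower hupper hI hI'
    grind
  obtain ⟨x, hx1, hx2⟩ := span_nonempty hlt
  have e : x - 2 * δ + δ + δ = x := by ring
  refine ⟨x - 2 * δ, ⟨?_, ?_⟩, ?_⟩
  · rw [← Endpoint.shift_le_shift_iff (2 * δ), Endpoint.minus_shift, sub_add_cancel]
    exact hx1
  · rw [← Endpoint.shift_le_shift_iff (2 * δ), Endpoint.plus_shift, sub_add_cancel]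
    exact hx2.trans hupper
  · rw [e]
    exact ⟨hlower.trans hx1, hx2⟩

/-! ### Matchings from interleavings -/

section Matching

variable {K : Type u} [Field K] {M N : PersistenceModule K} {ι κ : Type*}
  {b : ι → Bar M} {b' : κ → Bar N} {δ : ℝ}

/-- The matrix entries at `t` of a morphism `M → N(δ)` with respect to bases of bars. -/
noncomputable def entry (b : ι → Bar M) (hb' : IsBarBasis b') (f : M ⟶ (shift δ).obj N) (i : ι)
    (j : κ) (t : ℝ) : K :=
  hb'.coord j (t + δ) (appShift f t ((b i).v t))

/-- An entry does not depend on time. It is not assumed that `t` lies in the source interval or `s +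
δ` in the target one, and this is what `leShift_of_entry_ne_zero` exploits. -/
theorem entry_eq (hb' : IsBarBasis b') (f : M ⟶ (shift δ).obj N) {i : ι} {j : κ} {s t : ℝ}
    (hst : s ≤ t) (hs : s ∈ (b i).I.carrier) (ht : t + δ ∈ (b' j).I.carrier) :
    entry b hb' f i j t = entry b hb' f i j s := by
  rw [entry, ← (b i).map hst hs, appShift_trans, hb'.coord_trans _ ht]
  rfl

theorem mem_of_entry_ne_zero {hb' : IsBarBasis b'} {f : M ⟶ (shift δ).obj N} {i : ι} {j : κ}
    {t : ℝ} (h : entry b hb' f i j t ≠ 0) :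
    t ∈ (b i).I.carrier ∧ t + δ ∈ (b' j).I.carrier := by
  constructor
  · by_contra ht
    exact h (by rw [entry, (b i).zero t ht, map_zero, map_zero])
  · by_contra ht
    exact h (by rw [entry, hb'.coord_of_notMem ht]; rfl)

theorem leShift_of_entry_ne_zero {hb' : IsBarBasis b'} {f : M ⟶ (shift δ).obj N} {i : ι} {j : κ}
    {t : ℝ} (h : entry b hb' f i j t ≠ 0) : (b i).I.LeShift δ (b' j).I := by
  obtain ⟨hti, htj⟩ := mem_of_entry_ne_zero h
  constructor
  · by_contra hlt
    -- At time `x - δ` the source bar is already born while the target is not, so the entry there is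
    -- zero, yet it equals the nonzero entry at `t`.
    obtain ⟨x, hx1, hx2⟩ := span_nonempty (not_le.1 hlt)
    have hxt : x < t + δ := (Endpoint.plus_le_minus_iff _ _).1 (hx2.trans htj.1)
    have hx : x - δ + δ = x := sub_add_cancel x δ
    have hmem : x - δ ∈ (b i).I.carrier := by
      refine ⟨?_, ((Endpoint.plus_le_plus_iff _ _).2 (by linarith)).trans hti.2⟩
      rw [← Endpoint.shift_le_shift_iff δ, Endpoint.minus_shift, hx]
      exact hx1
    rw [entry_eq hb' f (by linarith : x - δ ≤ t) hmem htj] at h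
    have := (mem_of_entry_ne_zero h).2.1
    rw [hx] at this
    exact absurd (hx2.trans this) (not_le.2 (Endpoint.minus_lt_plus x))
  · by_contra hlt
    obtain ⟨x, hx1, hx2⟩ := span_nonempty (not_le.1 hlt)
    have hx : x - δ + δ = x := sub_add_cancel x δ
    have htx : t + δ < x := (Endpoint.plus_le_minus_iff _ _).1
      ((Endpoint.shift_mono δ hti.2).trans hx1)
    have hmem : x - δ + δ ∈ (b' j).I.carrier := by
      rw [hx]
      exact ⟨htj.1.trans ((Endpoint.minus_le_minus_iff _ _).2 htx.le), hx2⟩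
    rw [← entry_eq hb' f (by linarith : t ≤ x - δ) hti hmem] at h
    have := Endpoint.shift_mono δ (mem_of_entry_ne_zero h).1.2
    change (Endpoint.plus (x - δ)).shift δ ≤ _ at this
    rw [Endpoint.plus_shift, hx] at this
    exact absurd (this.trans hx1) (not_le.2 (Endpoint.minus_lt_plus x))

open scoped Classical in
/-- The matrix coefficients of a morphism `M → N(δ)` with respect to bases of bars. -/
noncomputable def coeff (b : ι → Bar M) (hb' : IsBarBasis b') (f : M ⟶ (shift δ).obj N) (i : ι)
    (j : κ) : K :=
  if h : ∃ t, entry b hb' f i j t ≠ 0 then entry b hb' f i j h.choose else 0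

theorem leShift_of_coeff_ne_zero {hb' : IsBarBasis b'} {f : M ⟶ (shift δ).obj N} {i : ι} {j : κ}
    (h : coeff b hb' f i j ≠ 0) : (b i).I.LeShift δ (b' j).I := by
  by_cases he : ∃ t, entry b hb' f i j t ≠ 0
  · exact leShift_of_entry_ne_zero he.choose_spec
  · exact absurd (dif_neg he) h

theorem entry_eq_coeff (hb' : IsBarBasis b') (f : M ⟶ (shift δ).obj N) {i : ι} {j : κ} {t : ℝ}
    (ht : t ∈ (b i).I.carrier) (ht' : t + δ ∈ (b' j).I.carrier) :
    entry b hb' f i j t = coeff b hb' f i j := by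
  rw [coeff]
  split_ifs with he
  · obtain ⟨h1, h2⟩ := mem_of_entry_ne_zero he.choose_spec
    rcases le_total t he.choose with h | h
    · exact (entry_eq hb' f h ht h2).symm
    · exact entry_eq hb' f h h1 ht'
  · by_contra h
    exact he ⟨t, h⟩

/-- The full matrix of `g(δ) ∘ f` is that of the `2δ`-transition. By `RInterval.LeShift.symm_or`, a
bar `k` contributing to entry `(i, j)` is matchable with `i` or with `j`, so restricting the sum to
`T` loses nothing. -/
theorem sum_coeff_mul_coeff (hb : IsBarBasis b) (hb' : IsBarBasis b') (hN : IsPFD N) (hδ : 0 ≤ δ)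
    (f : M ⟶ (shift δ).obj N) (g : N ⟶ (shift δ).obj M)
    (hfg : ∀ t, (f ≫ (shift δ).map g).app t = M.map (homOfLE (by linarith : t ≤ t + δ + δ)))
    [DecidableEq ι] {i j : ι} (hi : (b i).I.lower.shift (2 * δ) < (b i).I.upper)
    (hj : (b j).I.lower.shift (2 * δ) < (b j).I.upper) (hc : (b i).I.centre ≤ (b j).I.centre)
    (T : Finset κ)
    (hTi : ∀ k, (b i).I.LeShift δ (b' k).I → (b' k).I.LeShift δ (b i).I → k ∈ T)
    (hTj : ∀ k, (b j).I.LeShift δ (b' k).I → (b' k).I.LeShift δ (b j).I → k ∈ T) :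
    ∑ k ∈ T, coeff b hb' f i k * coeff b' hb g k j = if i = j then 1 else 0 := by
  by_cases ht : ∃ t, t ∈ (b i).I.carrier ∧ t + δ + δ ∈ (b j).I.carrier
  · obtain ⟨t, hti, htj⟩ := ht
    have hle : t ≤ t + δ + δ := by linarith
    have hcomp : appShift g (t + δ) (appShift f t ((b i).v t)) = (b i).v (t + δ + δ) := by
      rw [← (b i).map hle hti]
      exact congrArg (fun φ => φ.hom ((b i).v t)) (hfg t)
    -- Coordinate `j` of `g (f (b i))` is expanded over the bars of `N` at the intermediate time `t
    -- + δ`.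
    have hsum := hb'.apply_eq_sum hN (hb.coord j (t + δ + δ) ∘ₗ appShift g (t + δ))
      (appShift f t ((b i).v t)) T ?_
    · rw [LinearMap.comp_apply, hcomp] at hsum
      have hlhs : hb.coord j (t + δ + δ) ((b i).v (t + δ + δ)) = if i = j then 1 else 0 := by
        split_ifs with hij
        · subst hij
          exact hb.coord_self htj
        · exact hb.coord_of_ne (Ne.symm hij) _
      rw [← hlhs, hsum]
      refine Finset.sum_congr rfl fun k _ => ?_
      by_cases hk : t + δ ∈ (b' k).I.carrier
      · rw [← entry_eq_coeff hb' f hti hk, ← entry_eq_coeff hb g hk htj]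
        rfl
      · rw [hb'.coord_of_notMem hk, LinearMap.zero_apply, zero_mul]
        by_contra hne
        have h1 := leShift_of_coeff_ne_zero (left_ne_zero_of_mul hne)
        have h2 := leShift_of_coeff_ne_zero (right_ne_zero_of_mul hne)
        exact hk ⟨h1.lower_le hti.1, h2.le_upper htj.2⟩
    · intro k hkT hk
      by_contra hne
      have h1 : (b i).I.LeShift δ (b' k).I :=
        leShift_of_entry_ne_zero (hb' := hb') (f := f) (left_ne_zero_of_mul hne)
      have h2 : (b' k).I.LeShift δ (b j).I :=
        leShift_of_entry_ne_zero (hb' := hb) (f := g) (right_ne_zero_of_mul hne)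
      rcases h1.symm_or hδ h2 hc with h | h
      · exact hkT (hTi k h1 h)
      · exact hkT (hTj k h h2)
  -- With no common time, a nonzero term would contradict `exists_mem`. Moreover `i ≠ j`, since a
  -- bar longer than `2δ` meets its own translate.
  · rw [if_neg]
    · refine Finset.sum_eq_zero fun k _ => ?_
      by_contra hne
      exact ht ((leShift_of_coeff_ne_zero (left_ne_zero_of_mul hne)).exists_mem hδ
        (leShift_of_coeff_ne_zero (right_ne_zero_of_mul hne)) hi hj hc)
    · rintro rfl
      obtain ⟨x, hx1, hx2⟩ := span_nonempty hi
      have hlow : (b i).I.lower ≤ Endpoint.minus (x - 2 * δ) := by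
        rw [← Endpoint.shift_le_shift_iff (2 * δ), Endpoint.minus_shift, sub_add_cancel]
        exact hx1
      refine ht ⟨x - 2 * δ, ⟨hlow, ((Endpoint.plus_le_plus_iff _ _).2 (by linarith)).trans hx2⟩, ?_⟩
      have e : x - 2 * δ + δ + δ = x := by ring
      rw [e]
      exact ⟨hlow.trans ((Endpoint.minus_le_minus_iff _ _).2 (by linarith)), hx2⟩

/-- This is Hall's theorem for the long bars of `M`. There may be infinitely many of them, so each
must have finitely many neighbours: all are alive at one time `x - δ`, where `x` lies in the bar at
distance more than `2δ` from its birth, up to decorations. -/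
theorem exists_injective_of_interleaving (hb : IsBarBasis b) (hb' : IsBarBasis b') (hN : IsPFD N)
    (hδ : 0 ≤ δ) (f : M ⟶ (shift δ).obj N) (g : N ⟶ (shift δ).obj M)
    (hfg : ∀ t, (f ≫ (shift δ).map g).app t = M.map (homOfLE (by linarith : t ≤ t + δ + δ))) :
    ∃ m : {i | (b i).I.lower.shift (2 * δ) < (b i).I.upper} → κ, Function.Injective m ∧
      ∀ i, (b i.1).I.LeShift δ (b' (m i)).I ∧ (b' (m i)).I.LeShift δ (b i.1).I := by
  classical
  have hfin : ∀ i : {i | (b i).I.lower.shift (2 * δ) < (b i).I.upper},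
      {k | (b i.1).I.LeShift δ (b' k).I ∧ (b' k).I.LeShift δ (b i.1).I}.Finite := by
    intro i
    obtain ⟨x, hx1, hx2⟩ := span_nonempty i.2
    refine (hb'.finite hN (x - δ)).subset fun k hk => ⟨?_, hk.2.le_upper ?_⟩
    · have e : x - δ = x - 2 * δ + δ := by ring
      rw [e]
      refine hk.1.lower_le ?_
      rw [← Endpoint.shift_le_shift_iff (2 * δ), Endpoint.minus_shift, sub_add_cancel]
      exact hx1
    · rwa [sub_add_cancel]
  obtain ⟨m, hm, hmem⟩ := (Finset.all_card_le_biUnion_card_iff_exists_injective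
    fun i => (hfin i).toFinset).1 fun s => by
      have h := card_le_card_of_triangular (ι := s)
        (κ := s.biUnion fun i => (hfin i).toFinset)
        (fun i k => coeff b hb' f i.1.1 k.1) (fun k i => coeff b' hb g k.1 i.1.1)
        (fun i => (b i.1.1).I.centre) (fun i j hij => by
          rw [Finset.sum_coe_sort _ fun k => coeff b hb' f i.1.1 k * coeff b' hb g k j.1.1,
            sum_coeff_mul_coeff hb hb' hN hδ f g hfg i.1.2 j.1.2 hij]
          · simp only [← Subtype.ext_iff]
          · exact fun k h h' =>
              Finset.mem_biUnion.2 ⟨i.1, i.2, (hfin _).mem_toFinset.2 ⟨h, h'⟩⟩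
          · exact fun k h h' =>
              Finset.mem_biUnion.2 ⟨j.1, j.2, (hfin _).mem_toFinset.2 ⟨h, h'⟩⟩)
      simpa only [Fintype.card_coe] using h
  exact ⟨m, hm, fun i => (hfin i).mem_toFinset.1 (hmem i)⟩

theorem deltaMatched_of_interleaved (hM : IsPFD M) (hN : IsPFD N) {C D : Barcode}
    (hC : IsBarcode M C) (hD : IsBarcode N D) {δ : ℝ≥0} (h : Interleaved δ M N) :
    DeltaMatched δ C D := by
  obtain ⟨b, hb, hbI⟩ := isBarcode_iff.1 hC
  obtain ⟨b', hb', hbI'⟩ := isBarcode_iff.1 hD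
  obtain ⟨f, g, hfg, hgf⟩ := h
  obtain ⟨m, hm, hm'⟩ := exists_injective_of_interleaving hb hb' hN δ.coe_nonneg f g hfg
  obtain ⟨n, hn, hn'⟩ := exists_injective_of_interleaving hb' hb hM δ.coe_nonneg g f hgf
  obtain ⟨σ, h1, h2, h3⟩ := exists_pequiv_covering
    (fun i j => (b i).I.LeShift δ (b' j).I ∧ (b' j).I.LeShift δ (b i).I) _ _ m hm hm' n hn
    fun j => (hn' j).symm
  simp only [hbI, hbI'] at h1 h2 h3
  exact ⟨σ, h1, h2, fun I J hIJ => subset_span_of_leShift (h3 I J hIJ).1 (h3 I J hIJ).2,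
    fun I J hIJ => subset_span_of_leShift (h3 I J hIJ).2 (h3 I J hIJ).1⟩

/-! ### Uniqueness of barcodes -/

theorem interleaved_zero_self (M : PersistenceModule K) : Interleaved 0 M M := by
  -- Since `t + 0` is not definitionally `t`, transition maps take the place of identities.
  let f : M ⟶ (shift ((0 : ℝ≥0) : ℝ)).obj M :=
    { app := fun t => M.map (homOfLE (by simp : t ≤ t + ((0 : ℝ≥0) : ℝ)))
      naturality := fun s t h => by
        change M.map _ ≫ M.map _ = M.map _ ≫ M.map _
        rw [← M.map_comp, ← M.map_comp]
        rfl }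
  have hf : ∀ t : ℝ, (f ≫ (shift ((0 : ℝ≥0) : ℝ)).map f).app t =
      M.map (homOfLE (by simp : t ≤ t + ((0 : ℝ≥0) : ℝ) + ((0 : ℝ≥0) : ℝ))) := by
    intro t
    change M.map _ ≫ M.map _ = M.map _
    rw [← M.map_comp]
    rfl
  exact ⟨f, f, hf, hf⟩

theorem DeltaMatched.symm {δ : ℝ≥0} {C D : Barcode} (h : DeltaMatched δ C D) :
    DeltaMatched δ D C := by
  obtain ⟨σ, hσ⟩ := h
  refine ⟨σ.symm, fun J hJ => ?_, fun I hI => ?_, fun J I h => ?_, fun J I h => ?_⟩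
  · obtain ⟨I, hI⟩ := hσ.im J hJ
    exact ⟨I, σ.mem_iff_mem.2 hI⟩
  · obtain ⟨J, hJ⟩ := hσ.dom I hI
    exact ⟨J, σ.mem_iff_mem.2 hJ⟩
  · exact hσ.subset_right I J (σ.mem_iff_mem.1 h)
  · exact hσ.subset_left I J (σ.mem_iff_mem.1 h)

/-- Every interval has `b < d`, so a 0-matching is defined on all of `C`; its two inclusions force
partners to be equal. It thus injects the copies of `I` in `C` into those in `D`. -/
theorem le_of_deltaMatched_zero {C D : Barcode} (h : DeltaMatched 0 C D) (I : RInterval) :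
    C I ≤ D I := by
  obtain ⟨σ, hσ⟩ := h
  have hdom : ∀ x : Fin (C I), ∃ y : D.Elements, y ∈ σ ⟨I, x⟩ := fun x => by
    refine hσ.dom ⟨I, x⟩ ?_
    simpa [Endpoint.shift_zero] using I.lower_lt_upper
  choose F hF using hdom
  have hFI : ∀ x, (F x).1 = I := by
    intro x
    have h1 := hσ.leShift_left (hF x)
    have h2 := hσ.leShift_right (hF x)
    simp only [RInterval.LeShift, NNReal.coe_zero, Endpoint.shift_zero] at h1 h2
    exact RInterval.ext (le_antisymm h1.1 h2.1) (le_antisymm h1.2 h2.2)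
  have hinj : Function.Injective fun x => Fin.cast (congrArg D (hFI x)) (F x).2 := by
    intro x x' hxx
    have e : F x = F x' := by
      refine Sigma.ext ((hFI x).trans (hFI x').symm) ?_
      refine (Fin.heq_ext_iff (congrArg D ((hFI x).trans (hFI x').symm))).2 ?_
      exact congrArg (fun y : Fin (D I) => (y : ℕ)) hxx
    have h1 := hF x
    rw [e] at h1
    have := σ.inj h1 (hF x')
    exact eq_of_heq (Sigma.mk.inj this).2
  simpa using Fintype.card_le_of_injective _ hinj

theorem existsUnique_isBarcode (M : PersistenceModule K) (hM : IsPFD M) :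
    ∃! C, IsBarcode M C := by
  obtain ⟨C, hC⟩ := exists_isBarcode M hM
  refine ⟨C, hC, fun D hD => ?_⟩
  have h := deltaMatched_of_interleaved hM hM hC hD (interleaved_zero_self M)
  exact funext fun I => le_antisymm (le_of_deltaMatched_zero h.symm I) (le_of_deltaMatched_zero h I)

theorem isBarcode_barcode (M : PersistenceModule K) (hM : IsPFD M) : IsBarcode M (barcode M) := by
  have h := exists_isBarcode M hM
  have e : barcode M = h.choose := dif_pos h
  exact e ▸ h.choose_spec

theorem interleaved_iff_deltaMatched (hM : IsPFD M) (hN : IsPFD N) (δ : ℝ≥0) :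
    Interleaved δ M N ↔ DeltaMatched δ (barcode M) (barcode N) :=
  ⟨deltaMatched_of_interleaved hM hN (isBarcode_barcode M hM) (isBarcode_barcode N hN),
    interleaved_of_deltaMatched (isBarcode_barcode M hM) (isBarcode_barcode N hN)⟩

end Matching

end Persistence

/-- Pointwise finite-dimensional persistence modules `M` and `N` have unique barcodes, they are
`δ`-interleaved if and only if there is a `δ`-matching between their barcodes, and the bottleneck
distance of the barcodes equals the interleaving distance of the modules. -/
theorem mainTheorem1 {K : Type*} [Field K] (M N : Persistence.PersistenceModule K)
    (hM : Persistence.IsPFD M) (hN : Persistence.IsPFD N) :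
    (∃! C, Persistence.IsBarcode M C) ∧ (∃! D, Persistence.IsBarcode N D) ∧
    (∀ δ : ℝ≥0, Persistence.Interleaved δ M N ↔
      Persistence.DeltaMatched δ (Persistence.barcode M) (Persistence.barcode N)) ∧
    Persistence.bottleneckDist (Persistence.barcode M) (Persistence.barcode N) =
      Persistence.interleavingDist M N := by
  refine ⟨Persistence.existsUnique_isBarcode M hM, Persistence.existsUnique_isBarcode N hN,
    Persistence.interleaved_iff_deltaMatched hM hN, ?_⟩
  simp only [Persistence.bottleneckDist, Persistence.interleavingDist,
    Persistence.interleaved_iff_deltaMatched hM hN]
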